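/- **Setting.** Let $h=(h_1,\dots,h_D)\in\mathbb N^D$ be a histogram with $\sum_j h_j=n$, and let $\mathbf n=(n^{(1)}\ge\dots\ge n^{(D)})$ be its anonymized histogram (the entries of $h$ in non-increasing order). For a histogram $m$ put $\phi^{m}_{\ge r}=|\{j: m_j\ge r\}|$; below, $\|\cdot\|_1$-distances involving $\phi_{\ge}$ are over $r\in\{1,\dots,n\}$. For $H:[D]\to[B]$ let $m^{H}$ be the hashed histogram $m^{H}_i=\sum_{j:H(j)=i}m_j$, and let $\Gamma^B(m)_r=\mathbb E_H[\phi^{m^H}_{\ge r}]$ with $H$ uniformly random. For $p\in(0,1)$, $\mathrm{DLap}(p)$ is the distribution on $\mathbb Z$ with mass $\frac{1-p}{1+p}p^{|i|}$ at $i$, and $C_p=\frac{p^2}{(1-p)^5}+\frac{p}{1-p}$. **Algorithm.** The input consists of two independent noisy hashed histograms $X\in\mathbb Z^{B_1}$ and $Y\in\mathbb Z^{B_2}$ of $h$: each is obtained by hashing $h$ with a uniformly random hash function (into $B_1$, respectively $B_2$, buckets) and adding independent $\mathrm{DLap}(p)$ noise to every bucket. Let $\gamma=10\log(2nB_2)/\log(1/p)$,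 and let $f(m)=1$ for $m>0$, $f(0)=1+\frac p{(1-p)^2}$, $f(-1)=-\frac p{(1-p)^2}$, $f(m)=0$ for $m<-1$. 1. For $r\in[n]$ put $\hat\phi_{\ge r}=\sum_{j\in[B_1]}f(X_j-r)$, and let $\hat{\mathbf n}^{\mathrm{red}}$ be an anonymized histogram with $B_1$ entries minimizing $\|\phi_{\ge}^{\hat{\mathbf n}^{\mathrm{red}}}-\hat\phi_{\ge}\|_1$. 2. Let $\hat{\mathbf n}^1$ minimize $\|\Gamma^{B_1}(\hat{\mathbf n}^1)-\phi_{\ge}^{\hat{\mathbf n}^{\mathrm{red}}}\|_1$ among anonymized histograms with $D$ entries and $\|\hat{\mathbf n}^1\|_1=n$. 3. Output $\hat{\mathbf n}$ minimizing $\|\hat{\mathbf n}-\hat{\mathbf n}^1\|_1$ among anonymized histograms with $D$ entries, $\|\hat{\mathbf n}\|_1=n$ and $\|\mathbf n_Y-\hat{\mathbf n}\|_\infty\le\gamma$, where $\mathbf n_Y$ is $Y$ sorted in non-increasing order and vectors of different lengths are compared after appending zeros to the shorter one; if there is no such $\hat{\mathbf n}$, output the all-zero histogram. Ties between minimizers may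 be broken in any way. **Theorem.** There is an absolute constant $C>0$ such that for all $n,D$, all $p\in(0,1)$, all $B_1>4n$, all $B_2\ge1$ and all $h$ as above, the output satisfies $$\mathbb E\big[\|\hat{\mathbf n}-\mathbf n\|_2^2\big]\le C\,\frac{\log(nB_2)}{\log(1/p)}\left(\sqrt{C_p(n+B_1)\log n}+\frac{n\log n}{\sqrt{B_1}}\right)+C\left(\frac{n^4}{B_2}+1\right),$$ where for $n=0$ the terms with logarithms of $0$ are read as $0$. Moreover, there is an absolute constant $C'>0$ such that for all $n\ge2$ and $0<\varepsilon\le1$, with $p=e^{-\varepsilon/4}$, $B_1=n\sqrt{\log n}$ (rounded up or down to an integer) and $B_2=n^4$, $$\mathbb E\big[\|\hat{\mathbf n}-\mathbf n\|_2^2\big]\le C'\,\frac{\sqrt n\,(\log n)^{7/4}}{\varepsilon^{3.5}}.$$ -/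

import Mathlib

open MeasureTheory ProbabilityTheory
open scoped BigOperators ENNReal

namespace AnonHist

noncomputable section

/-- The anonymized version of a histogram: its entries listed in non-increasing order.
It is applied to genuine histograms (`α = ℕ`) and to noisy ones (`α = ℤ`). -/
def anonymize {α : Type*} [LinearOrder α] {m : ℕ} (h : Fin m → α) : Fin m → α :=
  fun i => h (Tuple.sort h i.rev)

/-- The cumulative prevalence: the number of entries of value at least `r`. -/
def cumPrev {m : ℕ} (h : Fin m → ℕ) (r : ℕ) : ℕ :=
  (Finset.univ.filter fun j => r ≤ h j).card

/-- The histogram after hashing: bucket `i` receives the sum of all entries hashed to it. -/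
def hashed {D B : ℕ} (H : Fin D → Fin B) (h : Fin D → ℕ) : Fin B → ℕ :=
  fun i => ∑ j ∈ Finset.univ.filter (fun j => H j = i), h j

/-- `Γ^B(m)_r`: the expected number of buckets of value at least `r`, over a uniformly random
hash function into `B` buckets (there are `B ^ D` of them). -/
def Gam {D : ℕ} (B : ℕ) (m : Fin D → ℕ) (r : ℕ) : ℝ :=
  (∑ H : Fin D → Fin B, (cumPrev (hashed H m) r : ℝ)) / (B : ℝ) ^ D

/-- The discrete Laplace distribution: mass `(1 - p) / (1 + p) * p ^ |i|` at `i : ℤ`. -/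
def dlap (p : ℝ) : Measure ℤ :=
  Measure.sum fun i : ℤ =>
    ENNReal.ofReal ((1 - p) / (1 + p) * p ^ i.natAbs) • Measure.dirac i

/-- The law of the noisy hashed histogram of `h`: a uniformly random hash function into `B`
buckets, and independent discrete Laplace noise added to each bucket. -/
def noisyHashedLaw {D : ℕ} (p : ℝ) (B : ℕ) (h : Fin D → ℕ) : Measure (Fin B → ℤ) :=
  Measure.map
    (fun q : (Fin D → Fin B) × (Fin B → ℤ) => fun i => (hashed q.1 h i : ℤ) + q.2 i)
    ((uniformOn (Set.univ : Set (Fin D → Fin B))).prod (Measure.pi fun _ => dlap p))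

/-- The function applied to each noisy count, an unbiased estimator of a threshold indicator. -/
def post (p : ℝ) (m : ℤ) : ℝ :=
  if 0 < m then 1
  else if m = 0 then 1 + p / (1 - p) ^ 2
  else if m = -1 then -(p / (1 - p) ^ 2)
  else 0

/-- The estimate of the cumulative prevalence at `r` from a noisy histogram. -/
def phiHat {B : ℕ} (p : ℝ) (x : Fin B → ℤ) (r : ℕ) : ℝ :=
  ∑ j, post p (x j - (r : ℤ))

/-- `m` is a possible output of the basic `ℓ₁` estimator on the noisy histogram `x`: an anonymized
histogram whose cumulative prevalence (at `1, …, n`) is `ℓ₁`-closest to the estimated one. -/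
def IsL1Estimate {B : ℕ} (n : ℕ) (p : ℝ) (x : Fin B → ℤ) (m : Fin B → ℕ) : Prop :=
  Antitone m ∧
    IsMinOn (fun m' : Fin B → ℕ => ∑ r ∈ Finset.Icc 1 n, |(cumPrev m' r : ℝ) - phiHat p x r|)
      {m' | Antitone m'} m

/-- The anonymized histograms with `D` entries and total count `n`. -/
def anonHistograms (n D : ℕ) : Set (Fin D → ℕ) :=
  {m | Antitone m ∧ ∑ j, m j = n}

/-- `m` is a possible output of the `ℓ₁` estimator for large domains on the noisy hashed
histogram `x`. -/
def IsHashedL1Estimate {B : ℕ} (n D : ℕ) (p : ℝ) (x : Fin B → ℤ) (m : Fin D → ℕ) : Prop :=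
  ∃ mred : Fin B → ℕ, IsL1Estimate n p x mred ∧ m ∈ anonHistograms n D ∧
    IsMinOn (fun m' : Fin D → ℕ => ∑ r ∈ Finset.Icc 1 n, |Gam B m' r - (cumPrev mred r : ℝ)|)
      (anonHistograms n D) m

/-- A finite sequence continued by zeros, so that sequences of different lengths compare. -/
def padded {m : ℕ} (x : Fin m → ℤ) (i : ℕ) : ℤ :=
  if hi : i < m then x ⟨i, hi⟩ else 0

/-- The radius `10 log (2 n B₂) / log (1 / p)` of the `ℓ_∞` constraint. -/
def radius (n B₂ : ℕ) (p : ℝ) : ℝ :=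
  10 * Real.log (2 * n * B₂) / Real.log (1 / p)

/-- The anonymized histograms of total count `n` whose `ℓ_∞` distance from the sorted second noisy
histogram `y` is at most the radius. -/
def nearSecond {B₂ : ℕ} (n D : ℕ) (p : ℝ) (y : Fin B₂ → ℤ) : Set (Fin D → ℕ) :=
  {m | m ∈ anonHistograms n D ∧ ∀ i : ℕ,
    |((padded (anonymize y) i - padded (fun j => (m j : ℤ)) i : ℤ) : ℝ)| ≤ radius n B₂ p}

/-- `m` is a possible output of the two-hash `ℓ₂²` estimator on the noisy hashed histograms
`x` and `y` (any tie-breaking among minimizers is allowed). -/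
def IsTwoHashEstimate {B₁ B₂ : ℕ} (n D : ℕ) (p : ℝ) (x : Fin B₁ → ℤ) (y : Fin B₂ → ℤ)
    (m : Fin D → ℕ) : Prop :=
  ∃ m₁ : Fin D → ℕ, IsHashedL1Estimate n D p x m₁ ∧
    ((m ∈ nearSecond n D p y ∧
        IsMinOn (fun m' : Fin D → ℕ => ∑ j, |(m' j : ℝ) - (m₁ j : ℝ)|) (nearSecond n D p y) m) ∨
      (nearSecond n D p y = ∅ ∧ m = 0))

/-- A random run of the two-hash estimator on the histogram `h` with `n` users: `X` and `Y` are
independent noisy hashed histograms of `h` with `B₁` and `B₂` buckets, and the random variable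
`nhat` is an output of the estimator on them. -/
structure IsTwoHashRun {D : ℕ} (n B₁ B₂ : ℕ) (p : ℝ) (h : Fin D → ℕ)
    {Ω : Type*} [MeasurableSpace Ω] (P : Measure Ω)
    (X : Ω → Fin B₁ → ℤ) (Y : Ω → Fin B₂ → ℤ) (nhat : Ω → Fin D → ℕ) : Prop where
  law_fst : HasLaw X (noisyHashedLaw p B₁ h) P
  law_snd : HasLaw Y (noisyHashedLaw p B₂ h) P
  indep : IndepFun X Y P
  aemeasurable : AEMeasurable nhat P
  output : ∀ᵐ ω ∂P, IsTwoHashEstimate n D p (X ω) (Y ω) (nhat ω)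

/-- The `ℓ₂²` error of the estimate `m` of the anonymized histogram of `h`. -/
def l2sqError {D : ℕ} (h m : Fin D → ℕ) : ℝ :=
  ∑ j, ((m j : ℝ) - ((anonymize h j : ℕ) : ℝ)) ^ 2

/-- `C_p = p² / (1 - p)⁵ + p / (1 - p)`. -/
def Cp (p : ℝ) : ℝ := p ^ 2 / (1 - p) ^ 5 + p / (1 - p)

end

end AnonHist

namespace AnonHist

/-! ### Sorting -/

/-! A squared `ℓ₂` distance is at most the `ℓ_∞` distance times the `ℓ₁` distance, and each of the
two noisy histograms controls one factor.

The second one controls `ℓ_∞`. If no two items collide and no noise exceeds the radius, then sorted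
`Y` is within the radius of the truth (`abs_padded_anonymize_sub_le`). The truth is then feasible in
the last step, and the output is within twice the radius of it. This fails with probability at most
`n² / B₂` plus a noise tail, and then the error is still at most `2 n²`.

The first one controls `ℓ₁`. Between anonymized histograms of equal total, the `ℓ₁` distance is the
`ℓ₁` distance of cumulative prevalences. One more user on item `j` changes `Γ - φ` only through the
hash functions under which some mass collides with `j`, and the mean colliding mass is at most `n /
B`. Hence `Γ - φ` is Lipschitz with constant `2 n / B < 1 / 2`, and `Γ` can be inverted at the cost
of a factor `2` (`l1_le_two_mul_l1_Gam`).

What remains is the `ℓ₁` size of two fluctuations: hashed prevalences around `Γ`, and noisy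
estimates around hashed prevalences. Cauchy–Schwarz with weights `1 / r` costs a factor `log n` and
leaves second moments weighted by `r`. For hashing, Efron–Stein against a copy in which one item is
isolated gives `O(n² / B)` (`weighted_variance_hash`). For the noise, `post` is unbiased and its
second moment decays geometrically in the distance of the count from `r`, which gives `O(C_p (n +
B))` (`weighted_variance_noise`). -/

theorem exists_perm_anonymize {α : Type*} [LinearOrder α] {m : ℕ} (h : Fin m → α) :
    ∃ σ : Equiv.Perm (Fin m), anonymize h = h ∘ σ :=
  ⟨Fin.revPerm.trans (Tuple.sort h), rfl⟩

theorem antitone_anonymize {α : Type*} [LinearOrder α] {m : ℕ} (h : Fin m → α) :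
    Antitone (anonymize h) :=
  fun _ _ hij => Tuple.monotone_sort h (Fin.rev_le_rev.2 hij)

theorem card_filter_comp_perm {α : Type*} [LinearOrder α] {m : ℕ} (h : Fin m → α)
    (σ : Equiv.Perm (Fin m)) (r : α) :
    (Finset.univ.filter fun j => r ≤ (h ∘ σ) j).card =
      (Finset.univ.filter fun j => r ≤ h j).card := by
  rw [← Fintype.card_subtype, ← Fintype.card_subtype]
  exact Fintype.card_congr (σ.subtypeEquiv fun _ => Iff.rfl)

/-- In a non-increasing list the entries of value at least `r` form an initial segment. This turns
comparisons of sorted lists into comparisons of counts. -/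
theorem le_anonymize_iff {α : Type*} [LinearOrder α] {m : ℕ} (h : Fin m → α) (i : Fin m) (r : α) :
    r ≤ anonymize h i ↔ (i : ℕ) < (Finset.univ.filter fun j => r ≤ h j).card := by
  obtain ⟨σ, hσ⟩ := exists_perm_anonymize h
  rw [← card_filter_comp_perm h σ r, ← hσ]
  exact (Tuple.lt_card_ge_iff_apply_ge_of_antitone (antitone_anonymize h)).symm

theorem cumPrev_comp_perm {m : ℕ} (h : Fin m → ℕ) (σ : Equiv.Perm (Fin m)) (r : ℕ) :
    cumPrev (h ∘ σ) r = cumPrev h r :=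
  card_filter_comp_perm h σ r

theorem cumPrev_anonymize {m : ℕ} (h : Fin m → ℕ) (r : ℕ) :
    cumPrev (anonymize h) r = cumPrev h r := by
  obtain ⟨σ, hσ⟩ := exists_perm_anonymize h
  rw [hσ, cumPrev_comp_perm]

theorem anonymize_mem_anonHistograms {n D : ℕ} {h : Fin D → ℕ} (hn : ∑ j, h j = n) :
    anonymize h ∈ anonHistograms n D := by
  refine ⟨antitone_anonymize h, ?_⟩
  obtain ⟨σ, hσ⟩ := exists_perm_anonymize h
  rw [hσ, ← hn]
  exact Equiv.sum_comp σ h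

theorem hashed_comp_perm {D B : ℕ} (m : Fin D → ℕ) (σ : Equiv.Perm (Fin D)) (H : Fin D → Fin B) :
    hashed (H ∘ σ) (m ∘ σ) = hashed H m := by
  ext i
  simp only [hashed, Finset.sum_filter, Function.comp_apply]
  exact Equiv.sum_comp σ fun j => if H j = i then m j else 0

theorem Gam_comp_perm {D : ℕ} (B : ℕ) (m : Fin D → ℕ) (σ : Equiv.Perm (Fin D)) (r : ℕ) :
    Gam B (m ∘ σ) r = Gam B m r := by
  unfold Gam
  congr 1
  refine Fintype.sum_equiv (σ.arrowCongr (Equiv.refl (Fin B))) _ _ fun H => ?_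
  rw [← hashed_comp_perm m σ]
  congr 3
  ext j
  simp [Equiv.arrowCongr]

theorem Gam_anonymize {D : ℕ} (B : ℕ) (m : Fin D → ℕ) (r : ℕ) :
    Gam B (anonymize m) r = Gam B m r := by
  obtain ⟨σ, hσ⟩ := exists_perm_anonymize m
  rw [hσ, Gam_comp_perm]

/-! ### The `ℓ₁` distance through cumulative prevalences -/

theorem cumPrev_eq_sum {m : ℕ} (h : Fin m → ℕ) (r : ℕ) :
    (cumPrev h r : ℝ) = ∑ j, if r ≤ h j then (1 : ℝ) else 0 := by
  simp [cumPrev]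

theorem abs_sub_eq_sum_indicator {a b n : ℕ} (ha : a ≤ n) (hb : b ≤ n) :
    |(a : ℝ) - b| =
      ∑ r ∈ Finset.Icc 1 n, |(if r ≤ a then (1 : ℝ) else 0) - if r ≤ b then 1 else 0| := by
  wlog hab : b ≤ a generalizing a b
  · rw [abs_sub_comm, this hb ha (le_of_not_ge hab)]
    exact Finset.sum_congr rfl fun _ _ => abs_sub_comm _ _
  have key : ∀ r ∈ Finset.Icc 1 n,
      |(if r ≤ a then (1 : ℝ) else 0) - if r ≤ b then 1 else 0| =
        if r ∈ Finset.Ioc b a then 1 else 0 := by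
    intro r _
    by_cases h1 : r ≤ a <;> by_cases h2 : r ≤ b <;> simp [h1, h2]
    omega
  rw [Finset.sum_congr rfl key, Finset.sum_ite_mem, Finset.inter_eq_right.2]
  · simp [Nat.cast_sub hab, abs_of_nonneg, hab]
  · intro r hr
    simp only [Finset.mem_Ioc, Finset.mem_Icc] at *
    omega

/-- The superlevel sets of antitone sequences are initial segments, so one contains the other and
all differences have the same sign. -/
theorem sum_abs_indicator_eq {D : ℕ} {a b : Fin D → ℕ} (ha : Antitone a) (hb : Antitone b)
    (r : ℕ) :
    ∑ j, |(if r ≤ a j then (1 : ℝ) else 0) - if r ≤ b j then 1 else 0| =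
      |(cumPrev a r : ℝ) - cumPrev b r| := by
  wlog hab : ∀ j, r ≤ b j → r ≤ a j generalizing a b
  · have hba : ∀ j, r ≤ a j → r ≤ b j := by
      push Not at hab
      obtain ⟨k, hk1, hk2⟩ := hab
      intro j hj
      rcases le_total j k with h | h
      · exact hk1.trans (hb h)
      · exact absurd (hj.trans (ha h)) (not_le.2 hk2)
    rw [abs_sub_comm, ← this hb ha hba]
    exact Finset.sum_congr rfl fun _ _ => abs_sub_comm _ _
  rw [cumPrev_eq_sum, cumPrev_eq_sum, ← Finset.sum_sub_distrib, abs_of_nonneg]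
  · refine Finset.sum_congr rfl fun j _ => abs_of_nonneg ?_
    have := hab j
    split_ifs <;> simp_all
  · refine Finset.sum_nonneg fun j _ => ?_
    have := hab j
    split_ifs <;> simp_all

theorem le_of_mem_anonHistograms {n D : ℕ} {a : Fin D → ℕ} (ha : a ∈ anonHistograms n D)
    (j : Fin D) : a j ≤ n :=
  ha.2 ▸ Finset.single_le_sum (fun _ _ => Nat.zero_le _) (Finset.mem_univ j)

theorem l1_eq_sum_cumPrev {n D : ℕ} {a b : Fin D → ℕ} (ha : a ∈ anonHistograms n D)
    (hb : b ∈ anonHistograms n D) :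
    ∑ j, |(a j : ℝ) - b j| = ∑ r ∈ Finset.Icc 1 n, |(cumPrev a r : ℝ) - cumPrev b r| := by
  simp_rw [← sum_abs_indicator_eq ha.1 hb.1]
  rw [Finset.sum_comm]
  exact Finset.sum_congr rfl fun j _ => abs_sub_eq_sum_indicator (le_of_mem_anonHistograms ha j)
    (le_of_mem_anonHistograms hb j)

/-! ### Hashing -/

/-- The mass that collides with item `j` under the hash function `H`. -/
def coll {D B : ℕ} (H : Fin D → Fin B) (m : Fin D → ℕ) (j : Fin D) : ℕ :=
  hashed H (Function.update m j 0) (H j)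

theorem hashed_eq_sum {D B : ℕ} (H : Fin D → Fin B) (m : Fin D → ℕ) (i : Fin B) :
    hashed H m i = ∑ k, if H k = i then m k else 0 := by
  simp [hashed, Finset.sum_filter]

theorem hashed_eq_add {D B : ℕ} (H : Fin D → Fin B) (m : Fin D → ℕ) (j : Fin D) (i : Fin B) :
    hashed H m i = hashed H (Function.update m j 0) i + if H j = i then m j else 0 := by
  rw [hashed_eq_sum, hashed_eq_sum, ← Finset.sum_erase_add _ _ (Finset.mem_univ j),
    ← Finset.sum_erase_add _ _ (Finset.mem_univ j)]
  simp only [Function.update_self, ite_self, add_zero]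
  congr 1
  refine Finset.sum_congr rfl fun k hk => ?_
  rw [Function.update_of_ne (Finset.ne_of_mem_erase hk)]

theorem hashed_apply_self {D B : ℕ} (H : Fin D → Fin B) (m : Fin D → ℕ) (j : Fin D) :
    hashed H m (H j) = coll H m j + m j := by
  rw [hashed_eq_add H m j, if_pos rfl, coll]

theorem hashed_of_ne {D B : ℕ} (H : Fin D → Fin B) (m : Fin D → ℕ) (j : Fin D) {i : Fin B}
    (hi : H j ≠ i) : hashed H m i = hashed H (Function.update m j 0) i := by
  rw [hashed_eq_add H m j, if_neg hi, add_zero]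

theorem sum_hashed {D B : ℕ} (H : Fin D → Fin B) (m : Fin D → ℕ) :
    ∑ i, hashed H m i = ∑ j, m j := by
  simp_rw [hashed_eq_sum]
  rw [Finset.sum_comm]
  simp

theorem indicator_eq_add (r M k : ℕ) :
    (if r ≤ M + k then (1 : ℝ) else 0) =
      (if r ≤ M then 1 else 0) + if M < r ∧ r ≤ M + k then 1 else 0 := by
  by_cases h1 : r ≤ M
  · simp [h1, not_lt.2 h1, h1.trans (Nat.le_add_right M k)]
  · simp [h1, not_le.1 h1]

/-- Only the bucket `H j` feels item `j`, which lifts it from `coll H m j` to `coll H m j + m j`.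
The first summand does not depend on `H j`, as Efron–Stein will require. -/
theorem cumPrev_hashed {D B : ℕ} (H : Fin D → Fin B) (m : Fin D → ℕ) (j : Fin D) (r : ℕ) :
    (cumPrev (hashed H m) r : ℝ) = cumPrev (hashed H (Function.update m j 0)) r +
      if coll H m j < r ∧ r ≤ coll H m j + m j then 1 else 0 := by
  rw [cumPrev_eq_sum, cumPrev_eq_sum, ← Finset.sum_erase_add _ _ (Finset.mem_univ (H j)),
    ← Finset.sum_erase_add (a := H j) _ _ (Finset.mem_univ (H j)), hashed_apply_self,
    indicator_eq_add, ← coll, add_assoc]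
  congr 1
  refine Finset.sum_congr rfl fun i hi => ?_
  rw [hashed_of_ne H m j (Finset.ne_of_mem_erase hi).symm]

theorem cumPrev_update {D : ℕ} (m : Fin D → ℕ) (j : Fin D) {r : ℕ} (hr : 1 ≤ r) :
    (cumPrev m r : ℝ) = cumPrev (Function.update m j 0) r + if r ≤ m j then 1 else 0 := by
  rw [cumPrev_eq_sum, cumPrev_eq_sum, ← Finset.sum_erase_add _ _ (Finset.mem_univ j),
    ← Finset.sum_erase_add (a := j) _ _ (Finset.mem_univ j)]
  rw [Function.update_self, if_neg (by omega : ¬ r ≤ 0), add_zero]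
  congr 1
  refine Finset.sum_congr rfl fun k hk => ?_
  rw [Function.update_of_ne (Finset.ne_of_mem_erase hk)]

/-- Shifting the value at `k` by `c` is a bijection between the fibres of `H k - H j`, so the `B`
fibres have equal size and together make up all hash functions. -/
theorem card_hash_eq {D B : ℕ} {j k : Fin D} (hjk : k ≠ j) :
    (Finset.univ.filter fun H : Fin D → Fin B => H k = H j).card * B = B ^ D := by
  classical
  have h1 : ∀ c : Fin B, (Finset.univ.filter fun H : Fin D → Fin B => H k = H j).card =
      (Finset.univ.filter fun H : Fin D → Fin B => H k - H j = c).card := by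
    intro c
    have : NeZero B := ⟨fun h => by subst h; exact c.elim0⟩
    refine Finset.card_bij (fun H _ => Function.update H k (H k + c)) ?_ ?_ ?_
    · intro H hH
      simp only [Finset.mem_filter, Finset.mem_univ, true_and] at hH ⊢
      rw [Function.update_self, Function.update_of_ne hjk.symm, hH]
      simp
    · intro H _ H' _ he
      ext i : 1
      by_cases hi : i = k
      · subst hi
        simpa using congrFun he i
      · simpa [Function.update_of_ne hi] using congrFun he i
    · intro H hH
      simp only [Finset.mem_filter, Finset.mem_univ, true_and] at hH
      refine ⟨Function.update H k (H k - c), ?_, ?_⟩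
      · simp only [Finset.mem_filter, Finset.mem_univ, true_and]
        rw [Function.update_self, Function.update_of_ne hjk.symm, ← hH]
        simp
      · simp
  have h2 : ∑ c : Fin B, (Finset.univ.filter fun H : Fin D → Fin B => H k - H j = c).card =
      B ^ D := by
    rw [← Finset.card_eq_sum_card_fiberwise (fun _ _ => Finset.mem_coe.2 (Finset.mem_univ _))]
    simp
  rw [← h2, ← Finset.sum_congr rfl fun c _ => h1 c]
  simp [mul_comm]

theorem sum_coll_le {D B : ℕ} (m : Fin D → ℕ) (j : Fin D) :
    (∑ H : Fin D → Fin B, (coll H m j : ℝ)) * B ≤ (∑ k, m k : ℕ) * (B : ℝ) ^ D := by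
  have h : (∑ H : Fin D → Fin B, coll H m j) * B ≤ (∑ k, m k) * B ^ D := by
    have h3 : ∑ H : Fin D → Fin B, coll H m j =
        ∑ k, (Finset.univ.filter fun H : Fin D → Fin B => H k = H j).card *
          Function.update m j 0 k := by
      simp_rw [coll, hashed_eq_sum]
      rw [Finset.sum_comm]
      refine Finset.sum_congr rfl fun k _ => ?_
      rw [← Finset.sum_filter, Finset.sum_const, smul_eq_mul]
    rw [h3, Finset.sum_mul, Finset.sum_mul]
    refine Finset.sum_le_sum fun k _ => ?_
    by_cases hk : k = j
    · subst hk; simp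
    · rw [Function.update_of_ne hk, mul_right_comm, card_hash_eq hk, mul_comm]
  exact_mod_cast h

/-! ### Stability of the hashed cumulative prevalences -/

theorem Gam_sub_eq {D B : ℕ} (hB : 0 < B) (m : Fin D → ℕ) (r : ℕ) (c : ℝ) :
    Gam B m r - c = (∑ H : Fin D → Fin B, ((cumPrev (hashed H m) r : ℝ) - c)) / (B : ℝ) ^ D := by
  have : (B : ℝ) ^ D ≠ 0 := by positivity
  rw [Gam, Finset.sum_sub_distrib, sub_div]
  simp [mul_div_cancel_left₀ _ this]

/-- Without colliding mass the two indicators coincide; otherwise at most two terms survive and `2 ≤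
2 * M`. Bounding by `M` means that only the mean colliding mass is needed. -/
theorem sum_abs_indicator_pair_le (n M k : ℕ) :
    ∑ r ∈ Finset.Icc 1 n, |(if r = M + k then (1 : ℝ) else 0) - if r = k then 1 else 0| ≤
      2 * M := by
  rcases Nat.eq_zero_or_pos M with rfl | hM
  · simp
  calc _ ≤ ∑ r ∈ Finset.Icc 1 n,
        ((if r = M + k then (1 : ℝ) else 0) + if r = k then 1 else 0) := by
        refine Finset.sum_le_sum fun r _ => ?_
        split_ifs <;> norm_num
    _ ≤ 1 + 1 := by
        rw [Finset.sum_add_distrib, Finset.sum_ite_eq', Finset.sum_ite_eq']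
        gcongr <;> split_ifs <;> norm_num
    _ ≤ 2 * M := by
        have : (1 : ℝ) ≤ M := by exact_mod_cast hM
        linarith

theorem indicator_succ_sub (r M k : ℕ) :
    ((if M < r ∧ r ≤ M + (k + 1) then (1 : ℝ) else 0) - if M < r ∧ r ≤ M + k then 1 else 0) =
      if r = M + (k + 1) then 1 else 0 := by
  split_ifs <;> first | (exfalso; omega) | norm_num

/-- The effect on `Γ - φ` of one more user on item `j`. -/
theorem l1_Gam_sub_cumPrev_succ {D B n : ℕ} (hB : 0 < B) (m : Fin D → ℕ) (j : Fin D)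
    (hm : ∑ k, m k ≤ n) :
    ∑ r ∈ Finset.Icc 1 n, |(Gam B (Function.update m j (m j + 1)) r -
        cumPrev (Function.update m j (m j + 1)) r) - (Gam B m r - cumPrev m r)| ≤
      2 * n / B := by
  set m' := Function.update m j (m j + 1) with hm'
  have hBD : (0 : ℝ) < (B : ℝ) ^ D := by positivity
  have hB' : (0 : ℝ) < B := by positivity
  have hup : Function.update m' j 0 = Function.update m j 0 := Function.update_idem _ _ _
  have hcoll : ∀ H : Fin D → Fin B, coll H m' j = coll H m j := fun H => by
    rw [coll, coll, hup]
  have hmj : m' j = m j + 1 := Function.update_self ..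
  have key : ∀ r ∈ Finset.Icc 1 n,
      |(Gam B m' r - cumPrev m' r) - (Gam B m r - cumPrev m r)| ≤
      (∑ H : Fin D → Fin B, |(if r = coll H m j + (m j + 1) then (1 : ℝ) else 0) -
        if r = m j + 1 then 1 else 0|) / (B : ℝ) ^ D := by
    intro r hr
    have hr1 : 1 ≤ r := (Finset.mem_Icc.1 hr).1
    rw [Gam_sub_eq hB, Gam_sub_eq hB, ← sub_div, ← Finset.sum_sub_distrib, abs_div,
      abs_of_pos hBD]
    gcongr
    refine (Finset.abs_sum_le_sum_abs _ _).trans (le_of_eq ?_)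
    refine Finset.sum_congr rfl fun H _ => ?_
    congr 1
    -- Both histograms agree off `j`, so only the new top level remains: `coll H m j + m j + 1`
    -- after hashing and `m j + 1` before.
    rw [cumPrev_hashed H m j, cumPrev_hashed H m' j, cumPrev_update m j hr1,
      cumPrev_update m' j hr1, hup, hcoll, hmj, ← indicator_succ_sub r (coll H m j)]
    have := indicator_succ_sub r 0 (m j)
    simp only [zero_add, show 0 < r from hr1, true_and] at this
    linarith
  calc _ ≤ ∑ r ∈ Finset.Icc 1 n, (∑ H : Fin D → Fin B,
        |(if r = coll H m j + (m j + 1) then (1 : ℝ) else 0) -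
          if r = m j + 1 then 1 else 0|) / (B : ℝ) ^ D := Finset.sum_le_sum key
    _ = (∑ H : Fin D → Fin B, ∑ r ∈ Finset.Icc 1 n,
        |(if r = coll H m j + (m j + 1) then (1 : ℝ) else 0) -
          if r = m j + 1 then 1 else 0|) / (B : ℝ) ^ D := by
        rw [← Finset.sum_div, Finset.sum_comm]
    _ ≤ (∑ H : Fin D → Fin B, 2 * (coll H m j : ℝ)) / (B : ℝ) ^ D := by
        gcongr with H
        exact sum_abs_indicator_pair_le _ _ _
    _ ≤ 2 * n / B := by
        rw [← Finset.mul_sum, div_le_div_iff₀ hBD hB', mul_assoc, mul_assoc]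
        refine mul_le_mul_of_nonneg_left ((sum_coll_le m j).trans ?_) zero_le_two
        gcongr

/-- Users are added one at a time on the way from `c` to `a`; every intermediate total stays at most
`n`, so the one-user bound applies at each step. -/
theorem l1_Gam_sub_cumPrev_of_le {D B n : ℕ} (hB : 0 < B) {a c : Fin D → ℕ} (hca : c ≤ a)
    (ha : ∑ k, a k ≤ n) :
    ∑ r ∈ Finset.Icc 1 n, |(Gam B a r - cumPrev a r) - (Gam B c r - cumPrev c r)| ≤
      2 * n / B * ∑ j, ((a j : ℝ) - c j) := by
  obtain ⟨N, hN⟩ : ∃ N, N = ∑ j, (a j - c j) := ⟨_, rfl⟩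
  induction N generalizing c with
  | zero =>
    have : a = c := by
      ext j
      have := (Finset.sum_eq_zero_iff.1 hN.symm) j (Finset.mem_univ j)
      exact le_antisymm (Nat.le_of_sub_eq_zero this) (hca j)
    subst this
    simp
  | succ N ih =>
    obtain ⟨j, -, hj⟩ : ∃ j ∈ Finset.univ, a j - c j ≠ 0 :=
      Finset.exists_ne_zero_of_sum_ne_zero (by omega)
    set c' := Function.update c j (c j + 1) with hc'
    have hc'a : c' ≤ a := by
      intro k
      by_cases hk : k = j
      · have : c j + 1 ≤ a j := by omega
        rw [hk, hc', Function.update_self]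
        exact this
      · rw [hc', Function.update_of_ne hk]; exact hca k
    have hsumc : ∀ {c : Fin D → ℕ}, c ≤ a → ∑ j, (a j - c j) + ∑ j, c j = ∑ j, a j := by
      intro c hc
      rw [← Finset.sum_add_distrib]
      exact Finset.sum_congr rfl fun j _ => Nat.sub_add_cancel (hc j)
    have hcc' : ∑ k, c' k = ∑ k, c k + 1 := by
      rw [← Finset.sum_erase_add _ _ (Finset.mem_univ j),
        ← Finset.sum_erase_add (a := j) _ c (Finset.mem_univ j), hc', Function.update_self,
        add_assoc]
      congr 1
      exact Finset.sum_congr rfl fun k hk => Function.update_of_ne (Finset.ne_of_mem_erase hk) ..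
    have h1 := hsumc hca
    have h2 := hsumc hc'a
    have hstep := l1_Gam_sub_cumPrev_succ (n := n) hB c j (by omega)
    have hih := ih hc'a (by omega)
    have hreal : ∑ j, ((a j : ℝ) - c j) = ∑ j, ((a j : ℝ) - c' j) + 1 := by
      rw [Finset.sum_sub_distrib, Finset.sum_sub_distrib]
      have : (∑ k, (c' k : ℝ)) = ∑ k, (c k : ℝ) + 1 := by exact_mod_cast hcc'
      linarith
    calc _ ≤ ∑ r ∈ Finset.Icc 1 n, (|(Gam B a r - cumPrev a r) - (Gam B c' r - cumPrev c' r)| +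
          |(Gam B c' r - cumPrev c' r) - (Gam B c r - cumPrev c r)|) :=
          Finset.sum_le_sum fun r _ => abs_sub_le _ _ _
      _ ≤ 2 * n / B * ∑ j, ((a j : ℝ) - c' j) + 2 * n / B := by
          rw [Finset.sum_add_distrib]
          exact add_le_add hih hstep
      _ = _ := by rw [hreal]; ring

/-- The path from `a` to `b` goes through the meet `a ⊓ b`: it lies below both, and the two legs add
up exactly to the `ℓ₁` distance. As `2 n / B ≤ 1 / 2`, the correction `Γ - φ` absorbs at most half
of that distance. -/
theorem l1_le_two_mul_l1_Gam {D B n : ℕ} (hB : 4 * n < B) {a b : Fin D → ℕ}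
    (ha : a ∈ anonHistograms n D) (hb : b ∈ anonHistograms n D) :
    ∑ j, |(a j : ℝ) - b j| ≤ 2 * ∑ r ∈ Finset.Icc 1 n, |Gam B a r - Gam B b r| := by
  have hB0 : 0 < B := by omega
  have hac := l1_Gam_sub_cumPrev_of_le (n := n) hB0 (inf_le_left : a ⊓ b ≤ a) ha.2.le
  have hbc := l1_Gam_sub_cumPrev_of_le (n := n) hB0 (inf_le_right : a ⊓ b ≤ b) hb.2.le
  set c := a ⊓ b with hc
  have habs : ∑ j, |(a j : ℝ) - b j| = ∑ j, ((a j : ℝ) - c j) + ∑ j, ((b j : ℝ) - c j) := by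
    rw [← Finset.sum_add_distrib]
    refine Finset.sum_congr rfl fun j _ => ?_
    rw [hc, Pi.inf_apply, Nat.cast_min]
    rcases le_total (a j : ℝ) (b j) with h | h
    · rw [min_eq_left h, abs_of_nonpos (by linarith)]; ring
    · rw [min_eq_right h, abs_of_nonneg (by linarith)]; ring
  have hhalf : 2 * (n : ℝ) / B ≤ 1 / 2 := by
    rw [div_le_div_iff₀ (by positivity) (by norm_num)]
    have : (4 * n : ℝ) < B := by exact_mod_cast hB
    linarith
  have hN : 0 ≤ ∑ j, |(a j : ℝ) - b j| := Finset.sum_nonneg fun _ _ => abs_nonneg _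
  have htri : ∑ j, |(a j : ℝ) - b j| ≤ ∑ r ∈ Finset.Icc 1 n, |Gam B a r - Gam B b r| +
      (∑ r ∈ Finset.Icc 1 n, |(Gam B a r - cumPrev a r) - (Gam B c r - cumPrev c r)| +
        ∑ r ∈ Finset.Icc 1 n, |(Gam B b r - cumPrev b r) - (Gam B c r - cumPrev c r)|) := by
    rw [l1_eq_sum_cumPrev ha hb, ← Finset.sum_add_distrib, ← Finset.sum_add_distrib]
    refine Finset.sum_le_sum fun r _ => ?_
    have h1 := abs_sub (Gam B a r - Gam B b r)
      (((Gam B a r - cumPrev a r) - (Gam B c r - cumPrev c r)) -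
        ((Gam B b r - cumPrev b r) - (Gam B c r - cumPrev c r)))
    have h2 := abs_sub ((Gam B a r - cumPrev a r) - (Gam B c r - cumPrev c r))
      ((Gam B b r - cumPrev b r) - (Gam B c r - cumPrev c r))
    rw [show (cumPrev a r : ℝ) - cumPrev b r = Gam B a r - Gam B b r -
      (((Gam B a r - cumPrev a r) - (Gam B c r - cumPrev c r)) -
        ((Gam B b r - cumPrev b r) - (Gam B c r - cumPrev c r))) by ring]
    linarith
  have h3 : 2 * (n : ℝ) / B * ∑ j, |(a j : ℝ) - b j| ≤ 1 / 2 * ∑ j, |(a j : ℝ) - b j| := by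
    gcongr
  rw [habs, mul_add] at h3
  rw [habs] at htri ⊢
  linarith

/-! ### The Efron–Stein inequality on a finite uniform product -/

theorem sum_sq_sub_eq {α : Type*} [Fintype α] (f : α → ℝ) (μ c : ℝ)
    (hμ : (Fintype.card α : ℝ) * μ = ∑ a, f a) :
    ∑ a, (f a - c) ^ 2 = ∑ a, (f a - μ) ^ 2 + Fintype.card α * (μ - c) ^ 2 := by
  have h : ∀ a, (f a - c) ^ 2 = (f a - μ) ^ 2 + (2 * (μ - c) * f a + (c ^ 2 - μ ^ 2)) := by
    intro a; ring
  simp_rw [h, Finset.sum_add_distrib, ← Finset.mul_sum, ← hμ]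
  simp only [Finset.sum_const, Finset.card_univ, nsmul_eq_mul]
  ring

/-- The usual form compares `F` with its average over coordinate `j`. That average is the best
approximation not depending on coordinate `j`, so any such `G j` may replace it. The induction
averages out the first coordinate. -/
theorem efron_stein {α : Type*} [Fintype α] [Nonempty α] : ∀ {D : ℕ} (F : (Fin D → α) → ℝ)
    (G : Fin D → (Fin D → α) → ℝ) (_ : ∀ j H a, G j (Function.update H j a) = G j H) (μ : ℝ)
    (_ : (Fintype.card α : ℝ) ^ D * μ = ∑ H, F H),
    ∑ H, (F H - μ) ^ 2 ≤ ∑ j, ∑ H, (F H - G j H) ^ 2 := by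
  intro D
  induction D with
  | zero =>
    intro F G _ μ hμ
    have : F default = μ := by simpa using hμ.symm
    simp [this]
  | succ D ih =>
    intro F G hG μ hμ
    have hK : (0 : ℝ) < Fintype.card α := by exact_mod_cast Fintype.card_pos
    have hsplit : ∀ Q : (Fin (D + 1) → α) → ℝ,
        ∑ H, Q H = ∑ H : Fin D → α, ∑ a, Q (Fin.cons a H) := by
      intro Q
      rw [← (Fin.consEquiv fun _ => α).sum_comp, Fintype.sum_prod_type, Finset.sum_comm]
      rfl
    set Fb : (Fin D → α) → ℝ := fun H => (∑ a, F (Fin.cons a H)) / Fintype.card α with hFb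
    set Gb : Fin D → (Fin D → α) → ℝ :=
      fun j H => (∑ a, G j.succ (Fin.cons a H)) / Fintype.card α with hGb
    have hFbm : ∀ H, (Fintype.card α : ℝ) * Fb H = ∑ a, F (Fin.cons a H) := fun H => by
      simp only [hFb]; field_simp
    have hGbi : ∀ j H a, Gb j (Function.update H j a) = Gb j H := by
      intro j H a
      simp only [hGb]
      congr 1
      refine Finset.sum_congr rfl fun b _ => ?_
      rw [Fin.cons_update, hG]
    have hmean : (Fintype.card α : ℝ) ^ D * μ = ∑ H, Fb H := by
      rw [hsplit] at hμ
      simp_rw [← hFbm] at hμ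
      rw [← Finset.mul_sum, pow_succ] at hμ
      have := mul_left_cancel₀ hK.ne' (show (Fintype.card α : ℝ) * _ = _ by
        rw [← hμ]; ring : (Fintype.card α : ℝ) * ((Fintype.card α : ℝ) ^ D * μ) = _)
      exact this
    have hIH := ih Fb Gb hGbi μ hmean
    rw [hsplit, Fin.sum_univ_succ]
    -- For fixed remaining coordinates `G 0` is a constant, and the mean minimizes the sum of
    -- squares.
    have h0 : ∀ H : Fin D → α, ∑ a, (F (Fin.cons a H) - Fb H) ^ 2 ≤
        ∑ a, (F (Fin.cons a H) - G 0 (Fin.cons a H)) ^ 2 := by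
      intro H
      obtain ⟨a₀⟩ := ‹Nonempty α›
      have hc : ∀ a, G 0 (Fin.cons a H) = G 0 (Fin.cons a₀ H) := by
        intro a
        rw [← hG 0 (Fin.cons a₀ H) a, Fin.update_cons_zero]
      simp_rw [hc]
      rw [sum_sq_sub_eq (fun a => F (Fin.cons a H)) (Fb H) (G 0 (Fin.cons a₀ H))
        (hFbm H)]
      have : 0 ≤ (Fintype.card α : ℝ) * (Fb H - G 0 (Fin.cons a₀ H)) ^ 2 := by positivity
      linarith
    -- Jensen: averaging over the first coordinate does not increase the mean square.
    have h1 : ∀ (j : Fin D) (H : Fin D → α), (Fintype.card α : ℝ) * (Fb H - Gb j H) ^ 2 ≤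
        ∑ a, (F (Fin.cons a H) - G j.succ (Fin.cons a H)) ^ 2 := by
      intro j H
      have hcs := sq_sum_le_card_mul_sum_sq (s := (Finset.univ : Finset α))
        (f := fun a => F (Fin.cons a H) - G j.succ (Fin.cons a H))
      have hd : ∑ a, (F (Fin.cons a H) - G j.succ (Fin.cons a H)) =
          Fintype.card α * (Fb H - Gb j H) := by
        rw [Finset.sum_sub_distrib, ← hFbm]
        simp only [hGb]
        field_simp
      rw [hd, mul_pow, sq (Fintype.card α : ℝ), mul_assoc, Finset.card_univ] at hcs
      exact le_of_mul_le_mul_left hcs hK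
    -- The law of total variance with respect to the first coordinate.
    calc ∑ H : Fin D → α, ∑ a, (F (Fin.cons a H) - μ) ^ 2
        = ∑ H : Fin D → α, ∑ a, (F (Fin.cons a H) - Fb H) ^ 2 +
          Fintype.card α * ∑ H, (Fb H - μ) ^ 2 := by
          rw [Finset.mul_sum, ← Finset.sum_add_distrib]
          exact Finset.sum_congr rfl fun H _ => sum_sq_sub_eq _ _ _ (hFbm H)
      _ ≤ ∑ H : Fin D → α, ∑ a, (F (Fin.cons a H) - G 0 (Fin.cons a H)) ^ 2 +
          Fintype.card α * ∑ j, ∑ H, (Fb H - Gb j H) ^ 2 := by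
          exact add_le_add (Finset.sum_le_sum fun H _ => h0 H) (by gcongr)
      _ ≤ _ := by
          rw [hsplit, Finset.mul_sum]
          gcongr with j
          rw [hsplit, Finset.mul_sum]
          exact Finset.sum_le_sum fun H _ => h1 j H

/-! ### The error due to hashing -/

theorem one_le_two_mul_log {n : ℕ} (hn : 2 ≤ n) : 1 ≤ 2 * Real.log n := by
  have h1 := Real.log_two_gt_d9
  have h2 : Real.log 2 ≤ Real.log n := Real.log_le_log (by norm_num) (by exact_mod_cast hn)
  linarith

theorem sum_inv_Icc_le {n : ℕ} (hn : 2 ≤ n) :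
    ∑ r ∈ Finset.Icc 1 n, (r : ℝ)⁻¹ ≤ 3 * Real.log n := by
  have h1 := harmonic_le_one_add_log n
  rw [harmonic_eq_sum_Icc] at h1
  push_cast at h1
  have := one_le_two_mul_log hn
  linarith

/-- Cauchy–Schwarz with weights `1 / r`, whose harmonic sum is `O(log n)`. The weight `r` on the
right is affordable because large levels are reached by few buckets. -/
theorem sq_sum_abs_le {n : ℕ} (hn : 2 ≤ n) (x : ℕ → ℝ) :
    (∑ r ∈ Finset.Icc 1 n, |x r|) ^ 2 ≤
      3 * Real.log n * ∑ r ∈ Finset.Icc 1 n, (r : ℝ) * x r ^ 2 := by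
  have h0 : 0 ≤ ∑ r ∈ Finset.Icc 1 n, (r : ℝ) * x r ^ 2 :=
    Finset.sum_nonneg fun _ _ => by positivity
  refine (Finset.sum_sq_le_sum_mul_sum_of_sq_le_mul _ (f := fun r : ℕ => (r : ℝ)⁻¹)
    (g := fun r : ℕ => (r : ℝ) * x r ^ 2) (fun _ _ => by positivity) (fun _ _ => by positivity)
    fun r hr => ?_).trans (mul_le_mul_of_nonneg_right (sum_inv_Icc_le hn) h0)
  have : (r : ℝ) ≠ 0 := by
    have := (Finset.mem_Icc.1 hr).1
    positivity
  rw [sq_abs, inv_mul_cancel_left₀ this]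

/-- The intervals `(M, M + k]` and `[1, k]` differ in two blocks of length `min M k`: a low one with
`r ≤ min M k` and a high one with `r ≤ M + k`. The total is at most `min² + min * (M + k) ≤ 3 M k`.
-/
theorem sum_weighted_sq_indicator_le (n M k : ℕ) :
    ∑ r ∈ Finset.Icc 1 n, (r : ℝ) * ((if M < r ∧ r ≤ M + k then (1 : ℝ) else 0) -
      if r ≤ k then 1 else 0) ^ 2 ≤ 3 * (M : ℝ) * k := by
  have key : ∀ r ∈ Finset.Icc 1 n, (r : ℝ) * ((if M < r ∧ r ≤ M + k then (1 : ℝ) else 0) -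
      if r ≤ k then 1 else 0) ^ 2 ≤
        (if r ∈ Finset.Icc 1 (min M k) then (min M k : ℝ) else 0) +
          if r ∈ Finset.Ioc (max M k) (M + k) then (M + k : ℝ) else 0 := by
    intro r hr
    have hr1 := (Finset.mem_Icc.1 hr).1
    have hcast : (min (M : ℝ) k) = ((min M k : ℕ) : ℝ) := by push_cast; rfl
    simp only [Finset.mem_Icc, Finset.mem_Ioc, hcast]
    have e1 : r ≤ min M k → (r : ℝ) ≤ ((min M k : ℕ) : ℝ) := fun h => by exact_mod_cast h
    have e2 : r ≤ M + k → (r : ℝ) ≤ M + k := fun h => by exact_mod_cast h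
    have e3 : (0 : ℝ) ≤ ((min M k : ℕ) : ℝ) := by positivity
    have e4 : (0 : ℝ) ≤ (M : ℝ) + k := by positivity
    split_ifs <;>
      first
      | (exfalso; omega)
      | linarith
      | linarith [e1 (by omega)]
      | linarith [e2 (by omega)]
  refine (Finset.sum_le_sum key).trans ?_
  rw [Finset.sum_add_distrib, Finset.sum_ite_mem, Finset.sum_ite_mem, Finset.sum_const,
    Finset.sum_const, nsmul_eq_mul, nsmul_eq_mul]
  have c1 : ((Finset.Icc 1 n ∩ Finset.Icc 1 (min M k)).card : ℝ) ≤ min (M : ℝ) k := by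
    have := Finset.card_le_card
      (Finset.inter_subset_right : Finset.Icc 1 n ∩ Finset.Icc 1 (min M k) ⊆ _)
    rw [Nat.card_Icc, Nat.add_sub_cancel] at this
    exact_mod_cast this
  have c2 : ((Finset.Icc 1 n ∩ Finset.Ioc (max M k) (M + k)).card : ℝ) ≤ min (M : ℝ) k := by
    have := Finset.card_le_card
      (Finset.inter_subset_right : Finset.Icc 1 n ∩ Finset.Ioc (max M k) (M + k) ⊆ _)
    rw [Nat.card_Ioc, show M + k - max M k = min M k by omega] at this
    exact_mod_cast this
  have hM : (0 : ℝ) ≤ M := by positivity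
  have hk : (0 : ℝ) ≤ k := by positivity
  have hmin : 0 ≤ min (M : ℝ) k := le_min hM hk
  calc _ ≤ min (M : ℝ) k * min (M : ℝ) k + min (M : ℝ) k * (M + k) := by gcongr
    _ ≤ 3 * M * k := by
      rcases le_total (M : ℝ) k with h | h
      · rw [min_eq_left h]; nlinarith
      · rw [min_eq_right h]; nlinarith

/-- Efron–Stein at each level, with item `j` placed in a private bucket as the comparison. The
weighted sum over levels is at most `3 * coll * m j`, and the mean of `coll` is at most `n / B`. -/
theorem weighted_variance_hash {D B n : ℕ} (hB : 0 < B) {m : Fin D → ℕ} (hm : ∑ j, m j = n) :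
    (∑ H : Fin D → Fin B, ∑ r ∈ Finset.Icc 1 n,
      (r : ℝ) * ((cumPrev (hashed H m) r : ℝ) - Gam B m r) ^ 2) * B ≤
      3 * (n : ℝ) ^ 2 * (B : ℝ) ^ D := by
  have : Nonempty (Fin B) := ⟨⟨0, hB⟩⟩
  have hBD : (B : ℝ) ^ D ≠ 0 := by positivity
  have hES : ∀ r ∈ Finset.Icc 1 n,
      ∑ H : Fin D → Fin B, ((cumPrev (hashed H m) r : ℝ) - Gam B m r) ^ 2 ≤
      ∑ j, ∑ H : Fin D → Fin B, ((if coll H m j < r ∧ r ≤ coll H m j + m j then (1 : ℝ) else 0) -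
        if r ≤ m j then 1 else 0) ^ 2 := by
    intro r _
    refine (efron_stein (fun H : Fin D → Fin B => (cumPrev (hashed H m) r : ℝ))
      (fun j H => cumPrev (hashed H (Function.update m j 0)) r + if r ≤ m j then 1 else 0)
      ?_ (Gam B m r) ?_).trans (le_of_eq ?_)
    · intro j H a
      have : hashed (Function.update H j a) (Function.update m j 0) =
          hashed H (Function.update m j 0) := by
        ext i
        rw [hashed_eq_sum, hashed_eq_sum]
        refine Finset.sum_congr rfl fun k _ => ?_
        by_cases hk : k = j
        · subst hk; simp
        · rw [Function.update_of_ne hk]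
      simp only [this]
    · rw [Fintype.card_fin, Gam, mul_div_cancel₀ _ hBD]
    · refine Finset.sum_congr rfl fun j _ => Finset.sum_congr rfl fun H _ => ?_
      rw [cumPrev_hashed H m j, add_sub_add_left_eq_sub]
  calc _ = (∑ r ∈ Finset.Icc 1 n, (r : ℝ) * ∑ H : Fin D → Fin B,
        ((cumPrev (hashed H m) r : ℝ) - Gam B m r) ^ 2) * B := by
        rw [Finset.sum_comm]
        simp_rw [Finset.mul_sum]
    _ ≤ (∑ r ∈ Finset.Icc 1 n, (r : ℝ) * ∑ j, ∑ H : Fin D → Fin B,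
        ((if coll H m j < r ∧ r ≤ coll H m j + m j then (1 : ℝ) else 0) -
        if r ≤ m j then 1 else 0) ^ 2) * B := by
        gcongr with r hr
        exact hES r hr
    _ = (∑ j, ∑ H : Fin D → Fin B, ∑ r ∈ Finset.Icc 1 n, (r : ℝ) *
        ((if coll H m j < r ∧ r ≤ coll H m j + m j then (1 : ℝ) else 0) -
        if r ≤ m j then 1 else 0) ^ 2) * B := by
        simp_rw [Finset.mul_sum]
        rw [Finset.sum_comm]
        congr 1
        exact Finset.sum_congr rfl fun j _ => Finset.sum_comm
    _ ≤ (∑ j, ∑ H : Fin D → Fin B, 3 * (coll H m j : ℝ) * m j) * B := by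
        gcongr with j _ H _
        exact sum_weighted_sq_indicator_le _ _ _
    _ = ∑ j, 3 * (m j : ℝ) * ((∑ H : Fin D → Fin B, (coll H m j : ℝ)) * B) := by
        rw [Finset.sum_mul]
        refine Finset.sum_congr rfl fun j _ => ?_
        rw [← Finset.sum_mul, ← Finset.mul_sum]
        ring
    _ ≤ ∑ j, 3 * (m j : ℝ) * ((n : ℝ) * (B : ℝ) ^ D) := by
        refine Finset.sum_le_sum fun j _ => mul_le_mul_of_nonneg_left ?_ (by positivity)
        exact hm ▸ sum_coll_le m j
    _ = 3 * (n : ℝ) ^ 2 * (B : ℝ) ^ D := by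
        rw [← Finset.sum_mul, ← Finset.mul_sum]
        have : ∑ j, (m j : ℝ) = n := by exact_mod_cast hm
        rw [this]
        ring

/-- The expected `ℓ₁` distance of the hashed cumulative prevalence from its mean. -/
theorem mean_l1_hash_error_le {D B n : ℕ} (hB : 0 < B) (hn : 2 ≤ n) {m : Fin D → ℕ}
    (hm : ∑ j, m j = n) :
    (∑ H : Fin D → Fin B, ∑ r ∈ Finset.Icc 1 n, |(cumPrev (hashed H m) r : ℝ) - Gam B m r|) /
      (B : ℝ) ^ D ≤ 5 * (n * Real.log n / Real.sqrt B) := by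
  have hBD : (0 : ℝ) < (B : ℝ) ^ D := by positivity
  have hB' : (0 : ℝ) < B := by positivity
  have hlog := one_le_two_mul_log hn
  set S : (Fin D → Fin B) → ℝ :=
    fun H => ∑ r ∈ Finset.Icc 1 n, |(cumPrev (hashed H m) r : ℝ) - Gam B m r| with hS
  have h1 : (∑ H, S H) ^ 2 ≤ (B : ℝ) ^ D * ∑ H, S H ^ 2 := by
    have := sq_sum_le_card_mul_sum_sq (s := (Finset.univ : Finset (Fin D → Fin B))) (f := S)
    simpa using this
  have h2 : (∑ H, S H ^ 2) * B ≤ 3 * Real.log n * (3 * (n : ℝ) ^ 2 * (B : ℝ) ^ D) := by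
    refine le_trans ?_ (mul_le_mul_of_nonneg_left (weighted_variance_hash hB hm) (by linarith))
    rw [← mul_assoc, Finset.mul_sum]
    gcongr with H
    exact sq_sum_abs_le hn _
  have h3 : (∑ H, S H) ^ 2 * B ≤ 9 * Real.log n * (n : ℝ) ^ 2 * ((B : ℝ) ^ D) ^ 2 := by
    calc _ ≤ (B : ℝ) ^ D * ∑ H, S H ^ 2 * B := by
          rw [← Finset.sum_mul, ← mul_assoc]; gcongr
      _ ≤ (B : ℝ) ^ D * (3 * Real.log n * (3 * (n : ℝ) ^ 2 * (B : ℝ) ^ D)) := by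
          rw [← Finset.sum_mul]; gcongr
      _ = _ := by ring
  refine abs_le_of_sq_le_sq' ?_ (by positivity) |>.2
  rw [div_pow, mul_pow, div_pow, Real.sq_sqrt hB'.le, ← mul_div_assoc,
    div_le_div_iff₀ (by positivity) hB', mul_pow]
  refine h3.trans ?_
  -- Uses `log n ≥ 1 / 2`, so that `log n` can stand outside the square root in the final bound.
  have : 9 * Real.log n ≤ 5 ^ 2 * Real.log n ^ 2 := by nlinarith
  calc 9 * Real.log n * (n : ℝ) ^ 2 * ((B : ℝ) ^ D) ^ 2
      ≤ (5 ^ 2 * Real.log n ^ 2) * (n : ℝ) ^ 2 * ((B : ℝ) ^ D) ^ 2 := by gcongr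
    _ = _ := by ring

/-! ### Discrete Laplace noise -/

theorem dlap_weight_nonneg {p : ℝ} (hp0 : 0 < p) (hp1 : p < 1) (k : ℕ) :
    0 ≤ (1 - p) / (1 + p) * p ^ k := by
  have : 0 < 1 - p := by linarith
  positivity

theorem isProbabilityMeasure_dlap {p : ℝ} (hp0 : 0 < p) (hp1 : p < 1) :
    IsProbabilityMeasure (dlap p) := by
  constructor
  have h1p : 1 - p ≠ 0 := by linarith
  have hgeo := hasSum_geometric_of_lt_one hp0.le hp1
  have hZ : HasSum (fun i : ℤ => (1 - p) / (1 + p) * p ^ i.natAbs) 1 := by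
    have h : HasSum (fun i : ℤ => p ^ i.natAbs) ((1 - p)⁻¹ + p * (1 - p)⁻¹) := by
      refine HasSum.of_nat_of_neg_add_one (by simpa using hgeo) ?_
      refine (hgeo.mul_left p).congr_fun fun k => ?_
      rw [show (-((k : ℤ) + 1)).natAbs = k + 1 by omega, pow_succ']
    have h1 : 1 + p ≠ 0 := by linarith
    have hval : (1 - p) / (1 + p) * ((1 - p)⁻¹ + p * (1 - p)⁻¹) = 1 := by field_simp
    have h2 := h.mul_left ((1 - p) / (1 + p))
    rw [hval] at h2
    exact h2
  simp only [dlap]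
  rw [Measure.sum_apply _ MeasurableSet.univ]
  simp only [Measure.smul_apply, measure_univ, smul_eq_mul, mul_one]
  rw [← ENNReal.ofReal_tsum_of_nonneg (fun i => dlap_weight_nonneg hp0 hp1 _) hZ.summable,
    hZ.tsum_eq, ENNReal.ofReal_one]

theorem dlap_singleton (p : ℝ) (i : ℤ) :
    dlap p {i} = ENNReal.ofReal ((1 - p) / (1 + p) * p ^ i.natAbs) := by
  simp only [dlap]
  rw [Measure.sum_apply _ (MeasurableSet.singleton i), tsum_eq_single i]
  · simp
  · intro b hb
    simp [hb]

theorem dlap_tail_le {p : ℝ} (hp0 : 0 < p) (hp1 : p < 1) (t : ℕ) :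
    dlap p {z | t ≤ z.natAbs} ≤ ENNReal.ofReal (2 * p ^ t) := by
  have hsub : {z : ℤ | t ≤ z.natAbs} ⊆
      (⋃ k : ℕ, {((t + k : ℕ) : ℤ)}) ∪ ⋃ k : ℕ, {-((t + k : ℕ) : ℤ)} := by
    intro z hz
    have hz' : t ≤ z.natAbs := hz
    simp only [Set.mem_union, Set.mem_iUnion, Set.mem_singleton_iff]
    rcases le_total 0 z with h | h
    · exact Or.inl ⟨z.natAbs - t, by omega⟩
    · exact Or.inr ⟨z.natAbs - t, by omega⟩
  have hsum : HasSum (fun k : ℕ => (1 - p) / (1 + p) * p ^ (t + k)) (p ^ t / (1 + p)) := by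
    have h := (hasSum_geometric_of_lt_one hp0.le hp1).mul_left ((1 - p) / (1 + p) * p ^ t)
    have h1p : 1 - p ≠ 0 := by linarith
    have : 1 + p ≠ 0 := by linarith
    have hval : p ^ t / (1 + p) = (1 - p) / (1 + p) * p ^ t * (1 - p)⁻¹ := by field_simp
    rw [hval]
    exact h.congr_fun fun k => by rw [pow_add]; ring
  have hnn := fun k : ℕ => dlap_weight_nonneg hp0 hp1 (t + k)
  have hhalf : p ^ t / (1 + p) ≤ p ^ t := div_le_self (by positivity) (by linarith)
  calc dlap p {z | t ≤ z.natAbs}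
      ≤ ∑' k : ℕ, dlap p {((t + k : ℕ) : ℤ)} + ∑' k : ℕ, dlap p {-((t + k : ℕ) : ℤ)} :=
        (measure_mono hsub).trans ((measure_union_le _ _).trans
          (add_le_add (measure_iUnion_le _) (measure_iUnion_le _)))
    _ = ENNReal.ofReal (p ^ t / (1 + p)) + ENNReal.ofReal (p ^ t / (1 + p)) := by
        simp only [dlap_singleton, Int.natAbs_neg, Int.natAbs_natCast]
        rw [← ENNReal.ofReal_tsum_of_nonneg hnn hsum.summable, hsum.tsum_eq]
    _ ≤ ENNReal.ofReal (p ^ t) + ENNReal.ofReal (p ^ t) := by gcongr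
    _ = ENNReal.ofReal (2 * p ^ t) := by
        rw [← ENNReal.ofReal_add (by positivity) (by positivity), two_mul]

/-! ### Unbiasedness and second moment of the threshold estimator -/

theorem integral_dlap_of_support {p : ℝ} (hp0 : 0 < p) (hp1 : p < 1) {f : ℤ → ℝ} {c : ℝ}
    (hf : ∀ z, |f z| ≤ c) {e : ℕ → ℤ} (he : Function.Injective e) (N : ℕ)
    (heN : ∀ k, (e k).natAbs = N + k) (hsupp : ∀ z ∉ Set.range e, f z = 0) {s : ℝ}
    (hs : HasSum (fun k => p ^ k * f (e k)) s) :
    ∫ z, f z ∂(dlap p) = (1 - p) / (1 + p) * p ^ N * s := by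
  have := isProbabilityMeasure_dlap hp0 hp1
  have hint : Integrable f (dlap p) :=
    Integrable.of_bound (measurable_of_countable f).aestronglyMeasurable c
      (Filter.Eventually.of_forall hf)
  have h1 := hasSum_integral_measure (f := f) (by simpa only [dlap] using hint)
  simp only [integral_smul_measure, integral_dirac, smul_eq_mul,
    ENNReal.toReal_ofReal (dlap_weight_nonneg hp0 hp1 _)] at h1
  -- Only the ray enumerated by `e` contributes, and on it the mass is geometric with the factor `p
  -- ^ N` in front.
  have h2 : HasSum (fun i : ℤ => (1 - p) / (1 + p) * p ^ i.natAbs * f i)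
      ((1 - p) / (1 + p) * p ^ N * s) := by
    refine (he.hasSum_iff fun z hz => by rw [hsupp z hz, mul_zero]).1 ?_
    refine (hs.mul_left ((1 - p) / (1 + p) * p ^ N)).congr_fun fun k => ?_
    rw [Function.comp_apply, heN, pow_add]
    ring
  exact h1.unique h2

/-- The second moment of the error of `post`, up to the geometric factor. -/
noncomputable def errConst (p : ℝ) : ℝ :=
  (p / (1 - p) ^ 2) ^ 2 + p * (1 + p / (1 - p) ^ 2) ^ 2 + p ^ 2 / (1 - p)

/-- The deviation of `post` from the threshold indicator. -/
noncomputable def postErr (p : ℝ) (d z : ℤ) : ℝ := post p (d + z) - if 0 ≤ d then 1 else 0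

/-- The distance of `d` from the threshold. -/
def gap (d : ℤ) : ℕ := if 0 ≤ d then d.natAbs else (-d - 1).natAbs

/-- The deviations of `post`, in the order of growing noise. -/
noncomputable def errSeq (p : ℝ) (k : ℕ) : ℝ := post p (-k) - 1

theorem errSeq_zero (p : ℝ) : errSeq p 0 = p / (1 - p) ^ 2 := by simp [errSeq, post]

theorem errSeq_one (p : ℝ) : errSeq p 1 = -(1 + p / (1 - p) ^ 2) := by
  simp [errSeq, post]; ring

theorem errSeq_add_two (p : ℝ) (k : ℕ) : errSeq p (k + 2) = -1 := by
  rw [errSeq, post, if_neg (by omega), if_neg (by omega), if_neg (by omega)]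
  norm_num

theorem hasSum_of_add_two {p : ℝ} (hp0 : 0 < p) (hp1 : p < 1) {g : ℕ → ℝ} {c : ℝ}
    (hg : ∀ k, g (k + 2) = c) :
    HasSum (fun k => p ^ k * g k) (g 0 + p * g 1 + c * (p ^ 2 / (1 - p))) := by
  have h : HasSum (fun k => p ^ (k + 2) * g (k + 2)) (c * (p ^ 2 / (1 - p))) := by
    rw [show c * (p ^ 2 / (1 - p)) = c * p ^ 2 * (1 - p)⁻¹ by ring]
    exact ((hasSum_geometric_of_lt_one hp0.le hp1).mul_left (c * p ^ 2)).congr_fun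
      fun k => by rw [hg, pow_add]; ring
  have h2 := (hasSum_nat_add_iff (f := fun k => p ^ k * g k) 2).1 h
  rw [Finset.sum_range_succ, Finset.sum_range_one, pow_zero, pow_one, one_mul, add_comm] at h2
  exact h2

/-- This cancellation is what determines the constant `p / (1 - p) ^ 2` in `post`. -/
theorem hasSum_errSeq {p : ℝ} (hp0 : 0 < p) (hp1 : p < 1) :
    HasSum (fun k => p ^ k * errSeq p k) 0 := by
  have h1p : 1 - p ≠ 0 := by linarith
  have hval : 0 = errSeq p 0 + p * errSeq p 1 + -1 * (p ^ 2 / (1 - p)) := by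
    rw [errSeq_zero, errSeq_one]
    field_simp
    ring
  rw [hval]
  exact hasSum_of_add_two hp0 hp1 (errSeq_add_two p)

theorem hasSum_errSeq_sq {p : ℝ} (hp0 : 0 < p) (hp1 : p < 1) :
    HasSum (fun k => p ^ k * errSeq p k ^ 2) (errConst p) := by
  have hval : errConst p = errSeq p 0 ^ 2 + p * errSeq p 1 ^ 2 + 1 * (p ^ 2 / (1 - p)) := by
    rw [errSeq_zero, errSeq_one, errConst]
    ring
  rw [hval]
  exact hasSum_of_add_two (g := fun k => errSeq p k ^ 2) hp0 hp1
    fun k => by rw [errSeq_add_two]; norm_num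

/-- The error is nonzero only if the noise carries the count to the threshold or across it. The
symmetry `post (-1 - m) = 1 - post m` makes both sides of the threshold show the same error sequence
up to the sign `σ`. -/
theorem postErr_eq (p : ℝ) (d : ℤ) : ∃ (e : ℕ → ℤ) (σ : ℝ), Function.Injective e ∧
    (∀ k, (e k).natAbs = gap d + k) ∧ (∀ z ∉ Set.range e, postErr p d z = 0) ∧
    (∀ k, postErr p d (e k) = σ * errSeq p k) ∧ σ ^ 2 = 1 := by
  rcases le_or_gt 0 d with hd | hd
  · refine ⟨fun k => -d - k, 1, fun a b h => ?_, fun k => ?_, fun z hz => ?_, fun k => ?_, ?_⟩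
    · simp only at h; omega
    · rw [gap, if_pos hd]; show (-d - (k : ℤ)).natAbs = _; omega
    · have : 0 < d + z := by
        by_contra h
        exact hz ⟨(-d - z).natAbs, by simp only; omega⟩
      rw [postErr, post, if_pos this, if_pos hd, sub_self]
    · rw [postErr, errSeq, if_pos hd, one_mul]
      congr 2
      ring
    · norm_num
  · refine ⟨fun k => -d - 1 + k, -1, fun a b h => ?_, fun k => ?_, fun z hz => ?_, fun k => ?_, ?_⟩
    · simp only at h; omega
    · rw [gap, if_neg (by omega)]; show (-d - 1 + (k : ℤ)).natAbs = _; omega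
    · have : d + z < -1 := by
        by_contra h
        exact hz ⟨(z + d + 1).natAbs, by simp only; omega⟩
      rw [postErr, post, if_neg (by omega), if_neg (by omega), if_neg (by omega),
        if_neg (by omega), sub_self]
    · rw [postErr, if_neg (by omega), show d + (-d - 1 + (k : ℤ)) = -1 + k by ring]
      match k with
      | 0 => rw [errSeq_zero]; simp [post]
      | 1 => rw [errSeq_one]; simp [post]
      | k + 2 =>
        rw [errSeq_add_two, post, if_pos (by push_cast; omega)]
        norm_num
    · norm_num

theorem abs_postErr_le {p : ℝ} (hp0 : 0 < p) (d z : ℤ) :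
    |postErr p d z| ≤ 2 + p / (1 - p) ^ 2 := by
  have h : 0 ≤ p / (1 - p) ^ 2 := by positivity
  rw [postErr, post, abs_le]
  split_ifs <;> constructor <;> linarith

theorem integral_postErr {p : ℝ} (hp0 : 0 < p) (hp1 : p < 1) (d : ℤ) :
    ∫ z, postErr p d z ∂(dlap p) = 0 := by
  obtain ⟨e, σ, he, heN, hsupp, heσ, -⟩ := postErr_eq p d
  rw [integral_dlap_of_support hp0 hp1 (abs_postErr_le hp0 d) he _ heN hsupp (s := σ * 0),
    mul_zero, mul_zero]
  refine ((hasSum_errSeq hp0 hp1).mul_left σ).congr_fun fun k => ?_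
  rw [heσ]; ring

theorem integral_postErr_sq {p : ℝ} (hp0 : 0 < p) (hp1 : p < 1) (d : ℤ) :
    ∫ z, postErr p d z ^ 2 ∂(dlap p) = (1 - p) / (1 + p) * p ^ gap d * errConst p := by
  obtain ⟨e, σ, he, heN, hsupp, heσ, hσ⟩ := postErr_eq p d
  refine integral_dlap_of_support hp0 hp1 (c := (2 + p / (1 - p) ^ 2) ^ 2) (fun z => ?_) he _ heN
    (fun z hz => by rw [hsupp z hz]; norm_num) ?_
  · rw [abs_pow]
    exact pow_le_pow_left₀ (abs_nonneg _) (abs_postErr_le hp0 d z) 2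
  · refine (hasSum_errSeq_sq hp0 hp1).congr_fun fun k => ?_
    rw [heσ, mul_pow, hσ, one_mul]

/-! ### The error due to the noise -/

theorem sum_comp_le_of_hasSum {ι κ : Type*} [DecidableEq κ] {s : Finset ι} {φ : ι → κ}
    (hφ : Set.InjOn φ s) {g : κ → ℝ} (hg : ∀ k, 0 ≤ g k) {S : ℝ} (hS : HasSum g S) :
    ∑ r ∈ s, g (φ r) ≤ S := by
  rw [← Finset.sum_image (f := g) hφ]
  exact sum_le_hasSum _ (fun k _ => hg k) hS

/-- On either side of `x` the gap is injective in `r`, so each side is bounded by a series: below,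
`r ≤ x` gives a geometric one; above, `r = x + gap + 1` adds an arithmetic-geometric one. -/
theorem sum_weighted_gap_le {p : ℝ} (hp0 : 0 < p) (hp1 : p < 1) (x n : ℕ) :
    ∑ r ∈ Finset.Icc 1 n, (r : ℝ) * p ^ gap ((x : ℤ) - r) ≤
      2 * x / (1 - p) + 1 / (1 - p) ^ 2 := by
  have h1p : 1 - p ≠ 0 := by linarith
  have hgeo := hasSum_geometric_of_lt_one hp0.le hp1
  have hlin : HasSum (fun k : ℕ => (x : ℝ) * p ^ k + ((k : ℝ) * p ^ k + p ^ k))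
      (x * (1 - p)⁻¹ + (p / (1 - p) ^ 2 + (1 - p)⁻¹)) :=
    (hgeo.mul_left _).add ((hasSum_coe_mul_geometric_of_norm_lt_one
      (by rwa [Real.norm_of_nonneg hp0.le])).add hgeo)
  rw [← Finset.sum_filter_add_sum_filter_not (Finset.Icc 1 n) (fun r => r ≤ x)]
  have h1 : ∑ r ∈ (Finset.Icc 1 n).filter (fun r => r ≤ x), (r : ℝ) * p ^ gap ((x : ℤ) - r) ≤
      x * (1 - p)⁻¹ := by
    refine le_trans (Finset.sum_le_sum fun r hr => ?_) (sum_comp_le_of_hasSum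
      (s := (Finset.Icc 1 n).filter fun r => r ≤ x) (φ := fun r => x - r)
      (g := fun k => (x : ℝ) * p ^ k) ?_ (fun k => by positivity) (hgeo.mul_left _))
    · have hr' : r ≤ x := (Finset.mem_filter.1 hr).2
      have : gap ((x : ℤ) - r) = x - r := by rw [gap, if_pos (by omega)]; omega
      rw [this]
      gcongr
    · intro a ha b hb hab
      simp only [Finset.coe_filter, Set.mem_ofPred_eq] at ha hb hab
      omega
  have h2 : ∑ r ∈ (Finset.Icc 1 n).filter (fun r => ¬ r ≤ x),
      (r : ℝ) * p ^ gap ((x : ℤ) - r) ≤ x * (1 - p)⁻¹ + (p / (1 - p) ^ 2 + (1 - p)⁻¹) := by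
    refine le_trans (Finset.sum_le_sum fun r hr => ?_) (sum_comp_le_of_hasSum
      (s := (Finset.Icc 1 n).filter fun r => ¬ r ≤ x) (φ := fun r => r - x - 1)
      (g := fun k : ℕ => (x : ℝ) * p ^ k + ((k : ℝ) * p ^ k + p ^ k)) ?_
      (fun k => by positivity) hlin)
    · have hr' : ¬ r ≤ x := (Finset.mem_filter.1 hr).2
      have hgap : gap ((x : ℤ) - r) = r - x - 1 := by rw [gap, if_neg (by omega)]; omega
      have hr2 : (r : ℝ) = x + ((r - x - 1 : ℕ) : ℝ) + 1 := by
        have : r = x + (r - x - 1) + 1 := by omega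
        exact_mod_cast this
      rw [hgap]
      refine le_of_eq ?_
      nth_rw 1 [hr2]
      ring
    · intro a ha b hb hab
      simp only [Finset.coe_filter, Set.mem_ofPred_eq] at ha hb hab
      omega
  refine (add_le_add h1 h2).trans (le_of_eq ?_)
  field_simp
  ring

theorem errConst_nonneg {p : ℝ} (hp0 : 0 < p) (hp1 : p < 1) : 0 ≤ errConst p := by
  have : 0 < 1 - p := by linarith
  unfold errConst
  positivity

theorem errConst_le {p : ℝ} (hp0 : 0 < p) (hp1 : p < 1) :
    errConst p / (1 - p) ≤ 4 * Cp p := by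
  obtain ⟨u, hu⟩ : ∃ u, u = (1 - p)⁻¹ := ⟨_, rfl⟩
  have hu1 : 1 ≤ u := hu ▸ (one_le_inv₀ (by linarith)).2 (by linarith)
  have h1 : errConst p / (1 - p) = (p ^ 2 * u ^ 4 + p * (1 + p * u ^ 2) ^ 2 + p ^ 2 * u) * u := by
    simp only [errConst, hu, div_eq_mul_inv, ← inv_pow]; ring
  have h2 : Cp p = p ^ 2 * u ^ 5 + p * u := by simp only [Cp, hu, div_eq_mul_inv, ← inv_pow]
  -- From `(1 + a)² ≤ 2 + 2 a²` and `p ≤ 1`.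
  have h3 : p * (1 + p * u ^ 2) ^ 2 ≤ 2 * p + 2 * (p ^ 2 * u ^ 4) := by
    have : p * (p ^ 2 * u ^ 4) ≤ 1 * (p ^ 2 * u ^ 4) := by gcongr
    nlinarith [mul_nonneg hp0.le (sq_nonneg (1 - p * u ^ 2))]
  have h4 : p ^ 2 * u ≤ p ^ 2 * u ^ 4 := by
    gcongr
    exact le_self_pow₀ hu1 (by norm_num)
  rw [h1, h2]
  calc _ ≤ (p ^ 2 * u ^ 4 + (2 * p + 2 * (p ^ 2 * u ^ 4)) + p ^ 2 * u ^ 4) * u := by gcongr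
    _ ≤ 4 * (p ^ 2 * u ^ 5 + p * u) := by nlinarith [mul_pos hp0 (by linarith : 0 < u)]

theorem measurable_of_pi_int {B : ℕ} {β : Type*} [MeasurableSpace β] (f : (Fin B → ℤ) → β) :
    Measurable f :=
  measurable_of_countable f

/-- Independent centred errors: the variances add up. -/
theorem integral_sum_postErr_sq {p : ℝ} (hp0 : 0 < p) (hp1 : p < 1) {B : ℕ} (d : Fin B → ℤ) :
    ∫ z, (∑ j, postErr p (d j) (z j)) ^ 2 ∂(Measure.pi fun _ : Fin B => dlap p) =
      ∑ j, (1 - p) / (1 + p) * p ^ gap (d j) * errConst p := by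
  have := isProbabilityMeasure_dlap hp0 hp1
  have hmem : ∀ j, MemLp (postErr p (d j)) 2 (dlap p) := fun j =>
    MemLp.of_bound (measurable_of_countable _).aestronglyMeasurable _
      (Filter.Eventually.of_forall (abs_postErr_le hp0 (d j)))
  have hvar := variance_sum_pi (μ := fun _ : Fin B => dlap p) hmem
  have hsum : (∑ j, fun z : Fin B → ℤ => postErr p (d j) (z j)) =
      fun z => ∑ j, postErr p (d j) (z j) := by
    ext z; simp
  rw [hsum, variance_of_integral_eq_zero (measurable_of_pi_int _).aemeasurable] at hvar
  · rw [hvar]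
    refine Finset.sum_congr rfl fun j _ => ?_
    rw [variance_of_integral_eq_zero (measurable_of_countable _).aemeasurable
      (integral_postErr hp0 hp1 _), integral_postErr_sq hp0 hp1]
  · rw [integral_finsetSum]
    · refine Finset.sum_eq_zero fun j _ => ?_
      rw [integral_comp_eval (μ := fun _ : Fin B => dlap p) (i := j)
        (measurable_of_countable _).aestronglyMeasurable, integral_postErr hp0 hp1]
    · intro j _
      exact integrable_comp_eval (μ := fun _ : Fin B => dlap p) (i := j)
        ((hmem j).integrable one_le_two)

theorem phiHat_sub_cumPrev {B : ℕ} (p : ℝ) (x : Fin B → ℕ) (z : Fin B → ℤ) (r : ℕ) :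
    phiHat p (fun i => (x i : ℤ) + z i) r - cumPrev x r =
      ∑ j, postErr p ((x j : ℤ) - r) (z j) := by
  rw [phiHat, cumPrev_eq_sum, ← Finset.sum_sub_distrib]
  refine Finset.sum_congr rfl fun j _ => ?_
  rw [postErr, add_sub_right_comm]
  simp only [sub_nonneg, Nat.cast_le]

theorem weighted_variance_noise {p : ℝ} (hp0 : 0 < p) (hp1 : p < 1) {B n : ℕ} {x : Fin B → ℕ}
    (hx : ∑ j, x j = n) :
    ∑ r ∈ Finset.Icc 1 n, (r : ℝ) * ∫ z, (phiHat p (fun i => (x i : ℤ) + z i) r -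
      cumPrev x r) ^ 2 ∂(Measure.pi fun _ : Fin B => dlap p) ≤ 8 * (Cp p * (n + B)) := by
  have h1p : 0 < 1 - p := by linarith
  have hE := errConst_nonneg hp0 hp1
  have hK : (1 - p) / (1 + p) ≤ 1 - p := div_le_self h1p.le (by linarith)
  have hxr : ∑ j, (x j : ℝ) = n := by exact_mod_cast hx
  simp_rw [phiHat_sub_cumPrev, integral_sum_postErr_sq hp0 hp1]
  calc _ = ∑ j, (1 - p) / (1 + p) * errConst p *
        ∑ r ∈ Finset.Icc 1 n, (r : ℝ) * p ^ gap ((x j : ℤ) - r) := by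
        simp_rw [Finset.mul_sum]
        rw [Finset.sum_comm]
        exact Finset.sum_congr rfl fun j _ => Finset.sum_congr rfl fun r _ => by ring
    _ ≤ ∑ j, (1 - p) * errConst p * (2 * x j / (1 - p) + 1 / (1 - p) ^ 2) := by
        gcongr with j _
        exact sum_weighted_gap_le hp0 hp1 _ _
    _ ≤ ∑ j, errConst p / (1 - p) * (2 * x j + 1) := by
        refine Finset.sum_le_sum fun j _ => ?_
        have : (1 - p) * errConst p * (2 * x j / (1 - p) + 1 / (1 - p) ^ 2) =
            errConst p / (1 - p) * ((1 - p) * (2 * x j) + 1) := by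
          field_simp
        rw [this]
        have h2 : (1 - p) * (2 * (x j : ℝ)) ≤ 1 * (2 * x j) := by gcongr; linarith
        exact mul_le_mul_of_nonneg_left (by linarith) (by positivity)
    _ ≤ ∑ j, 4 * Cp p * (2 * x j + 1) := by
        gcongr with j
        exact errConst_le hp0 hp1
    _ = 4 * Cp p * (2 * n + B) := by
        rw [← Finset.mul_sum, Finset.sum_add_distrib, ← Finset.mul_sum, hxr]
        simp
    _ ≤ _ := by
        have : 0 ≤ Cp p := by unfold Cp; positivity
        have hB : (0 : ℝ) ≤ B := by positivity
        nlinarith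

/-- The `ℓ₁` error of the estimated cumulative prevalence. -/
noncomputable def noiseErr {B : ℕ} (n : ℕ) (p : ℝ) (x : Fin B → ℕ) (z : Fin B → ℤ) : ℝ :=
  ∑ r ∈ Finset.Icc 1 n, |phiHat p (fun i => (x i : ℤ) + z i) r - cumPrev x r|

theorem abs_phiHat_sub_cumPrev_le {p : ℝ} (hp0 : 0 < p) {B : ℕ} (x : Fin B → ℕ) (z : Fin B → ℤ)
    (r : ℕ) : |phiHat p (fun i => (x i : ℤ) + z i) r - cumPrev x r| ≤
      B * (2 + p / (1 - p) ^ 2) := by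
  rw [phiHat_sub_cumPrev]
  refine (Finset.abs_sum_le_sum_abs _ _).trans ?_
  refine (Finset.sum_le_card_nsmul _ _ _ fun j _ => abs_postErr_le hp0 _ _).trans (le_of_eq ?_)
  rw [Finset.card_univ, Fintype.card_fin, nsmul_eq_mul]

theorem noiseErr_nonneg {B : ℕ} (n : ℕ) (p : ℝ) (x : Fin B → ℕ) (z : Fin B → ℤ) :
    0 ≤ noiseErr n p x z :=
  Finset.sum_nonneg fun _ _ => abs_nonneg _

theorem memLp_noiseErr {p : ℝ} (hp0 : 0 < p) (hp1 : p < 1) {B : ℕ} (n : ℕ) (x : Fin B → ℕ) :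
    MemLp (noiseErr n p x) 2 (Measure.pi fun _ : Fin B => dlap p) := by
  have := isProbabilityMeasure_dlap hp0 hp1
  refine MemLp.of_bound (measurable_of_pi_int _).aestronglyMeasurable
    (n * (B * (2 + p / (1 - p) ^ 2))) (Filter.Eventually.of_forall fun z => ?_)
  rw [Real.norm_of_nonneg (noiseErr_nonneg ..)]
  refine (Finset.sum_le_card_nsmul _ _ _ fun r _ => abs_phiHat_sub_cumPrev_le hp0 x z r).trans
    (le_of_eq ?_)
  simp

theorem integral_noiseErr_le {p : ℝ} (hp0 : 0 < p) (hp1 : p < 1) {B n : ℕ} (hn : 2 ≤ n)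
    {x : Fin B → ℕ} (hx : ∑ j, x j = n) :
    ∫ z, noiseErr n p x z ∂(Measure.pi fun _ : Fin B => dlap p) ≤
      5 * Real.sqrt (Cp p * (n + B) * Real.log n) := by
  have := isProbabilityMeasure_dlap hp0 hp1
  have hmem := memLp_noiseErr hp0 hp1 n x
  set μ := Measure.pi fun _ : Fin B => dlap p
  have hlog := one_le_two_mul_log hn
  -- Non-negativity of the variance serves as Jensen's inequality, bounding the squared mean by the
  -- second moment.
  have hvar := variance_nonneg (noiseErr n p x) μ
  rw [variance_eq_sub hmem] at hvar
  have hint : ∀ r : ℕ, Integrable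
      (fun z => (phiHat p (fun i => (x i : ℤ) + z i) r - cumPrev x r) ^ 2) μ := by
    intro r
    refine Integrable.of_bound (measurable_of_pi_int _).aestronglyMeasurable
      ((B * (2 + p / (1 - p) ^ 2)) ^ 2) (Filter.Eventually.of_forall fun z => ?_)
    rw [norm_pow]
    exact pow_le_pow_left₀ (norm_nonneg _) (abs_phiHat_sub_cumPrev_le hp0 x z r) 2
  have hsq : ∫ z, noiseErr n p x z ^ 2 ∂μ ≤ 3 * Real.log n * (8 * (Cp p * (n + B))) := by
    calc _ ≤ ∫ z, 3 * Real.log n * ∑ r ∈ Finset.Icc 1 n,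
          (r : ℝ) * (phiHat p (fun i => (x i : ℤ) + z i) r - cumPrev x r) ^ 2 ∂μ :=
          integral_mono hmem.integrable_sq
            ((integrable_finsetSum _ fun r _ => (hint r).const_mul _).const_mul _)
            fun z => sq_sum_abs_le hn _
      _ = 3 * Real.log n * ∑ r ∈ Finset.Icc 1 n, (r : ℝ) *
          ∫ z, (phiHat p (fun i => (x i : ℤ) + z i) r - cumPrev x r) ^ 2 ∂μ := by
          rw [integral_const_mul, integral_finsetSum _ fun r _ => (hint r).const_mul _]
          simp_rw [integral_const_mul]
      _ ≤ _ := by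
          exact mul_le_mul_of_nonneg_left (weighted_variance_noise hp0 hp1 hx) (by linarith)
  have hC : 0 ≤ Cp p * (n + B) * Real.log n := by
    have h1p : 0 < 1 - p := by linarith
    have : 0 ≤ Real.log n := by linarith
    unfold Cp
    positivity
  refine abs_le_of_sq_le_sq' ?_ (by positivity) |>.2
  rw [mul_pow, Real.sq_sqrt hC]
  have e : ∫ z, (noiseErr n p x ^ 2) z ∂μ = ∫ z, noiseErr n p x z ^ 2 ∂μ := rfl
  rw [e] at hvar
  nlinarith

/-! ### The estimator on a fixed input -/

/-- The `ℓ₁` distance of the hashed cumulative prevalence from its mean. -/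
noncomputable def hashErr {D B : ℕ} (n : ℕ) (h : Fin D → ℕ) (H : Fin D → Fin B) : ℝ :=
  ∑ r ∈ Finset.Icc 1 n, |(cumPrev (hashed H h) r : ℝ) - Gam B h r|

theorem hashErr_nonneg {D B : ℕ} (n : ℕ) (h : Fin D → ℕ) (H : Fin D → Fin B) :
    0 ≤ hashErr n h H :=
  Finset.sum_nonneg fun _ _ => abs_nonneg _

/-- The truth competes in both minimizations. Optimality of `mred` puts it within twice the noise
error of the hashed prevalences; optimality of `m` doubles the distance from `Γ(h)` to `mred`, and
inverting `Γ` doubles it again. Hence `4 * (hashErr + 2 * noiseErr)`. -/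
theorem l1_hashedL1Estimate_le {D B n : ℕ} {p : ℝ} {h : Fin D → ℕ} (hh : ∑ j, h j = n)
    (hB : 4 * n < B) (H : Fin D → Fin B) (z : Fin B → ℤ) {m : Fin D → ℕ}
    (hm : IsHashedL1Estimate n D p (fun i => (hashed H h i : ℤ) + z i) m) :
    ∑ j, |(m j : ℝ) - (anonymize h j : ℕ)| ≤
      8 * noiseErr n p (hashed H h) z + 4 * hashErr n h H := by
  obtain ⟨mred, ⟨-, hred⟩, hmem, hmin⟩ := hm
  have ha := anonymize_mem_anonHistograms hh
  have h1 := isMinOn_iff.1 hmin _ ha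
  have h2 := isMinOn_iff.1 hred (anonymize (hashed H h)) (antitone_anonymize _)
  simp only [cumPrev_anonymize, Gam_anonymize] at h1 h2
  set x : Fin B → ℤ := fun i => (hashed H h i : ℤ) + z i with hx
  have h2' : ∑ r ∈ Finset.Icc 1 n, |(cumPrev mred r : ℝ) - phiHat p x r| ≤
      noiseErr n p (hashed H h) z := by
    refine h2.trans (le_of_eq ?_)
    exact Finset.sum_congr rfl fun r _ => abs_sub_comm _ _
  have h3 : ∑ r ∈ Finset.Icc 1 n, |Gam B h r - cumPrev mred r| ≤
      hashErr n h H + (noiseErr n p (hashed H h) z + noiseErr n p (hashed H h) z) := by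
    refine le_trans ?_ (add_le_add_right (add_le_add_right h2' _) _)
    rw [hashErr, noiseErr, ← Finset.sum_add_distrib, ← Finset.sum_add_distrib]
    refine Finset.sum_le_sum fun r _ => ?_
    have e1 := abs_sub_le (Gam B h r) (cumPrev (hashed H h) r) (cumPrev mred r)
    have e2 := abs_sub_le (cumPrev (hashed H h) r : ℝ) (phiHat p x r) (cumPrev mred r)
    rw [abs_sub_comm (Gam B h r) (cumPrev (hashed H h) r)] at e1
    rw [abs_sub_comm (phiHat p x r) (cumPrev mred r),
      abs_sub_comm (cumPrev (hashed H h) r : ℝ) (phiHat p x r)] at e2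
    linarith
  have h4 : ∑ r ∈ Finset.Icc 1 n, |Gam B m r - Gam B (anonymize h) r| ≤
      ∑ r ∈ Finset.Icc 1 n, |Gam B m r - cumPrev mred r| +
        ∑ r ∈ Finset.Icc 1 n, |Gam B h r - cumPrev mred r| := by
    rw [← Finset.sum_add_distrib]
    refine Finset.sum_le_sum fun r _ => ?_
    rw [Gam_anonymize, abs_sub_comm (Gam B h r)]
    exact abs_sub_le _ _ _
  have h5 := l1_le_two_mul_l1_Gam hB hmem ha
  linarith

/-! ### Collision-free hashing and the `ℓ_∞` constraint -/

theorem coll_eq_zero {D B : ℕ} {H : Fin D → Fin B} {h : Fin D → ℕ} {j k : Fin D}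
    (hj : coll H h j = 0) (hk : H k = H j) (hkj : k ≠ j) : h k = 0 := by
  rw [coll, hashed_eq_sum, Finset.sum_eq_zero_iff] at hj
  simpa [hk, Function.update_of_ne hkj] using hj k (Finset.mem_univ k)

/-- No two items of the histogram `h` collide under the hash function `H`. -/
def NoCollision {D B : ℕ} (h : Fin D → ℕ) (H : Fin D → Fin B) : Prop :=
  ∀ j, h j ≠ 0 → coll H h j = 0

theorem cumPrev_hashed_of_noCollision {D B : ℕ} {h : Fin D → ℕ} {H : Fin D → Fin B}
    (hH : NoCollision h H) {r : ℕ} (hr : 1 ≤ r) : cumPrev (hashed H h) r = cumPrev h r := by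
  symm
  refine Finset.card_bij (fun j _ => H j) ?_ ?_ ?_
  · intro j hj
    simp only [Finset.mem_filter, Finset.mem_univ, true_and] at hj ⊢
    rw [hashed_apply_self]
    omega
  · intro j hj k hk hjk
    simp only [Finset.mem_filter, Finset.mem_univ, true_and] at hj hk
    by_contra hne
    have := coll_eq_zero (hH k (by omega)) hjk hne
    omega
  · intro b hb
    simp only [Finset.mem_filter, Finset.mem_univ, true_and] at hb
    have hne : ∑ k, (if H k = b then h k else 0) ≠ 0 := by
      rw [← hashed_eq_sum]; omega
    obtain ⟨k, -, hk⟩ := Finset.exists_ne_zero_of_sum_ne_zero hne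
    have hkb : H k = b := by
      by_contra hc
      exact hk (if_neg hc)
    rw [if_pos hkb] at hk
    refine ⟨k, ?_, hkb⟩
    simp only [Finset.mem_filter, Finset.mem_univ, true_and]
    rw [← hkb, hashed_apply_self, hH k hk] at hb
    omega

theorem cumPrev_le {m : ℕ} (h : Fin m → ℕ) (r : ℕ) : cumPrev h r ≤ m := by
  simpa [cumPrev] using Finset.card_le_univ (Finset.univ.filter fun j => r ≤ h j)

/-- Sorting the noisy hashed histogram moves each entry by at most the largest noise. -/
theorem abs_padded_anonymize_sub_le {D B : ℕ} {h : Fin D → ℕ} {H : Fin D → Fin B}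
    (hH : NoCollision h H) {z : Fin B → ℤ} {g : ℕ} (hz : ∀ i, (z i).natAbs ≤ g) (i : ℕ) :
    |padded (anonymize fun b => (hashed H h b : ℤ) + z b) i -
      padded (fun j => ((anonymize h j : ℕ) : ℤ)) i| ≤ g := by
  set y : Fin B → ℤ := fun b => (hashed H h b : ℤ) + z b with hy
  obtain ⟨u, hu⟩ : ∃ u : ℕ, padded (fun j => ((anonymize h j : ℕ) : ℤ)) i = u := by
    unfold padded
    split_ifs
    · exact ⟨_, rfl⟩
    · exact ⟨0, rfl⟩
  have hu1 : 1 ≤ u → i < cumPrev h u := by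
    intro h1
    unfold padded at hu
    split_ifs at hu with hi
    · have hu' : anonymize h ⟨i, hi⟩ = u := Nat.cast_injective (R := ℤ) hu
      exact (le_anonymize_iff h ⟨i, hi⟩ u).1 hu'.ge
    · omega
  have hu2 : ∀ r : ℕ, i < cumPrev h r → r ≤ u := by
    intro r hr
    have hi : i < D := hr.trans_le (cumPrev_le h r)
    rw [padded, dif_pos hi] at hu
    have := (le_anonymize_iff h ⟨i, hi⟩ r).2 hr
    omega
  rw [hu]
  by_cases hi : i < B
  · rw [padded, dif_pos hi]
    have hlow : (u : ℤ) - g ≤ anonymize y ⟨i, hi⟩ := by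
      rw [le_anonymize_iff]
      -- At level `0` the counts before and after hashing are `D` and `B`, so they transfer only for
      -- `u ≥ 1`. For `u = 0` every bucket is at least `-g`.
      rcases Nat.eq_zero_or_pos u with rfl | hpos
      · rw [Finset.filter_true_of_mem]
        · simpa using hi
        · intro b _
          have := hz b
          simp only [hy]
          omega
      · refine (hu1 hpos).trans_le ?_
        rw [← cumPrev_hashed_of_noCollision hH hpos]
        refine Finset.card_le_card fun b hb => ?_
        simp only [Finset.mem_filter, Finset.mem_univ, true_and, hy] at hb ⊢
        have := hz b
        omega
    have hhigh : anonymize y ⟨i, hi⟩ ≤ u + g := by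
      by_contra hc
      have hlt := (le_anonymize_iff y ⟨i, hi⟩ ((u : ℤ) + g + 1)).1 (by omega)
      have hle : (Finset.univ.filter fun b => (u : ℤ) + g + 1 ≤ y b).card ≤
          cumPrev (hashed H h) (u + 1) := by
        refine Finset.card_le_card fun b hb => ?_
        simp only [Finset.mem_filter, Finset.mem_univ, true_and, hy] at hb ⊢
        have := hz b
        omega
      rw [cumPrev_hashed_of_noCollision hH (by omega)] at hle
      have := hu2 (u + 1) (hlt.trans_le hle)
      omega
    rw [abs_le]
    constructor <;> linarith
  · rw [padded, dif_neg hi]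
    -- Beyond position `B` the padding is `0`, and a collision-free histogram has at most `B`
    -- positive entries.
    have : u = 0 := by
      by_contra hne
      have h1 := hu1 (by omega)
      rw [← cumPrev_hashed_of_noCollision hH (by omega)] at h1
      have := cumPrev_le (hashed H h) u
      omega
    simp [this]

/-- The second noisy histogram `y` determines the anonymized histogram of `h` up to the radius. -/
def IsClose {D B : ℕ} (n : ℕ) (p : ℝ) (h : Fin D → ℕ) (y : Fin B → ℤ) : Prop :=
  ∀ i : ℕ, |((padded (anonymize y) i - padded (fun j => ((anonymize h j : ℕ) : ℤ)) i : ℤ) : ℝ)| ≤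
    radius n B p

/-- One factor `2` is the triangle inequality through sorted `y` in `ℓ_∞`, the other is optimality
of `m` among feasible points in `ℓ₁`, where the truth is feasible. -/
theorem l2sqError_le_of_isClose {D B₁ B₂ n : ℕ} {p : ℝ} {h : Fin D → ℕ} (hh : ∑ j, h j = n)
    {x : Fin B₁ → ℤ} {y : Fin B₂ → ℤ} {m : Fin D → ℕ} (hm : IsTwoHashEstimate n D p x y m)
    (hy : IsClose n p h y) : ∃ m₁, IsHashedL1Estimate n D p x m₁ ∧
      l2sqError h m ≤ 4 * radius n B₂ p * ∑ j, |(m₁ j : ℝ) - (anonymize h j : ℕ)| := by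
  obtain ⟨m₁, hm₁, hm⟩ := hm
  refine ⟨m₁, hm₁, ?_⟩
  have ha : anonymize h ∈ nearSecond n D p y := ⟨anonymize_mem_anonHistograms hh, hy⟩
  rcases hm with ⟨⟨-, hnear⟩, hmin⟩ | ⟨hempty, -⟩
  swap
  · rw [hempty] at ha
    exact absurd ha (Set.notMem_empty _)
  have hle := isMinOn_iff.1 hmin _ ha
  have hR : 0 ≤ radius n B₂ p := (abs_nonneg _).trans (hy 0)
  have hinf : ∀ j, |(m j : ℝ) - (anonymize h j : ℕ)| ≤ 2 * radius n B₂ p := by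
    intro j
    have h1 := hnear j
    have h2 := hy j
    simp only [padded, j.2, dif_pos] at h1 h2
    push_cast at h1 h2
    rw [abs_le] at h1 h2 ⊢
    constructor <;> linarith [h1.1, h1.2, h2.1, h2.2]
  have htri : ∑ j, |(m j : ℝ) - (anonymize h j : ℕ)| ≤
      2 * ∑ j, |(m₁ j : ℝ) - (anonymize h j : ℕ)| := by
    calc _ ≤ ∑ j, (|(m j : ℝ) - m₁ j| + |(m₁ j : ℝ) - (anonymize h j : ℕ)|) :=
          Finset.sum_le_sum fun j _ => abs_sub_le _ _ _
      _ ≤ ∑ j, |((anonymize h j : ℕ) : ℝ) - m₁ j| + ∑ j, |(m₁ j : ℝ) - (anonymize h j : ℕ)| := by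
          rw [Finset.sum_add_distrib]
          gcongr
      _ = _ := by
          rw [two_mul]
          congr 1
          exact Finset.sum_congr rfl fun j _ => abs_sub_comm _ _
  calc l2sqError h m = ∑ j, |(m j : ℝ) - (anonymize h j : ℕ)| *
        |(m j : ℝ) - (anonymize h j : ℕ)| :=
        Finset.sum_congr rfl fun j _ => by rw [abs_mul_abs_self, sq]
    _ ≤ ∑ j, 2 * radius n B₂ p * |(m j : ℝ) - (anonymize h j : ℕ)| := by
        gcongr with j
        exact hinf j
    _ ≤ 2 * radius n B₂ p * (2 * ∑ j, |(m₁ j : ℝ) - (anonymize h j : ℕ)|) := by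
        rw [← Finset.mul_sum]
        gcongr
    _ = _ := by ring

theorem sum_sq_le_sq {D n : ℕ} {a : Fin D → ℕ} (ha : ∑ j, a j ≤ n) :
    ∑ j, (a j : ℝ) ^ 2 ≤ (n : ℝ) ^ 2 := by
  calc ∑ j, (a j : ℝ) ^ 2 ≤ (∑ j, (a j : ℝ)) ^ 2 :=
        Finset.sum_sq_le_sq_sum_of_nonneg fun _ _ => Nat.cast_nonneg _
    _ ≤ (n : ℝ) ^ 2 := by
        gcongr
        exact_mod_cast ha

theorem l2sqError_nonneg {D : ℕ} (h m : Fin D → ℕ) : 0 ≤ l2sqError h m :=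
  Finset.sum_nonneg fun _ _ => sq_nonneg _

theorem l2sqError_le {D B₁ B₂ n : ℕ} {p : ℝ} {h : Fin D → ℕ} (hh : ∑ j, h j = n)
    {x : Fin B₁ → ℤ} {y : Fin B₂ → ℤ} {m : Fin D → ℕ} (hm : IsTwoHashEstimate n D p x y m) :
    l2sqError h m ≤ 2 * (n : ℝ) ^ 2 := by
  have hmn : ∑ j, m j ≤ n := by
    obtain ⟨-, -, ⟨⟨hmem, -⟩, -⟩ | ⟨-, rfl⟩⟩ := hm
    · exact hmem.2.le
    · simp
  calc l2sqError h m ≤ ∑ j, ((m j : ℝ) ^ 2 + ((anonymize h j : ℕ) : ℝ) ^ 2) := by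
        refine Finset.sum_le_sum fun j _ => ?_
        have : 0 ≤ (m j : ℝ) * (anonymize h j : ℕ) := by positivity
        nlinarith
    _ ≤ (n : ℝ) ^ 2 + (n : ℝ) ^ 2 := by
        rw [Finset.sum_add_distrib]
        exact add_le_add (sum_sq_le_sq hmn) (sum_sq_le_sq (anonymize_mem_anonHistograms hh).2.le)
    _ = _ := by ring

/-! ### Averaging over the noisy hashed histograms -/

theorem lintegral_uniformOn_univ {α : Type*} [Fintype α] [MeasurableSpace α]
    [MeasurableSingletonClass α] (f : α → ℝ≥0∞) :
    ∫⁻ a, f a ∂(uniformOn (Set.univ : Set α)) = (Fintype.card α : ℝ≥0∞)⁻¹ * ∑ a, f a := by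
  rw [uniformOn, ProbabilityTheory.cond, Measure.restrict_univ, lintegral_smul_measure, lintegral_count,
    tsum_fintype, Measure.count_univ]
  simp

theorem lintegral_ofReal_uniformOn_hash {D B : ℕ} (hB : 0 < B) {f : (Fin D → Fin B) → ℝ}
    (hf : ∀ H, 0 ≤ f H) :
    ∫⁻ H, ENNReal.ofReal (f H) ∂(uniformOn (Set.univ : Set (Fin D → Fin B))) =
      ENNReal.ofReal ((∑ H, f H) / (B : ℝ) ^ D) := by
  have hBD : (0 : ℝ) < (B : ℝ) ^ D := by positivity
  rw [lintegral_uniformOn_univ, ← ENNReal.ofReal_sum_of_nonneg fun H _ => hf H,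
    ENNReal.ofReal_div_of_pos hBD, mul_comm, ← div_eq_mul_inv]
  congr 1
  rw [Fintype.card_fun, Fintype.card_fin, Fintype.card_fin, ← Nat.cast_pow,
    ENNReal.ofReal_natCast]

theorem isProbabilityMeasure_uniformOn_hash {D B : ℕ} (hB : 0 < B) :
    IsProbabilityMeasure (uniformOn (Set.univ : Set (Fin D → Fin B))) := by
  have : Nonempty (Fin B) := ⟨⟨0, hB⟩⟩
  exact isProbabilityMeasure_uniformOn Set.finite_univ Set.univ_nonempty

theorem measurable_noisyHash {D B : ℕ} (h : Fin D → ℕ) :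
    Measurable (fun q : (Fin D → Fin B) × (Fin B → ℤ) => fun i => (hashed q.1 h i : ℤ) + q.2 i) :=
  measurable_of_countable _

/-- The best bound on the `ℓ₁` error that some hash function certifies from the noisy histogram. -/
noncomputable def certErr {D B : ℕ} (n : ℕ) (p : ℝ) (h : Fin D → ℕ) (x : Fin B → ℤ) : ℝ≥0∞ :=
  ⨅ H : Fin D → Fin B, ENNReal.ofReal
    (8 * noiseErr n p (hashed H h) (fun i => x i - hashed H h i) + 4 * hashErr n h H)

/-- The deterministic bound holds for every `H`, since any `x` is a hashed histogram plus some
noise. The infimum is therefore a function of `x` alone, so the law of `X` suffices and no hash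
function has to be recovered from it. -/
theorem ofReal_l1_le_certErr {D B n : ℕ} {p : ℝ} {h : Fin D → ℕ} (hh : ∑ j, h j = n)
    (hB : 4 * n < B) {x : Fin B → ℤ} {m : Fin D → ℕ} (hm : IsHashedL1Estimate n D p x m) :
    ENNReal.ofReal (∑ j, |(m j : ℝ) - (anonymize h j : ℕ)|) ≤ certErr n p h x := by
  refine le_iInf fun H => ENNReal.ofReal_le_ofReal (l1_hashedL1Estimate_le hh hB H _ ?_)
  simpa using hm

theorem lintegral_certErr_le {D B n : ℕ} {p : ℝ} (hp0 : 0 < p) (hp1 : p < 1) (hB : 0 < B)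
    (hn : 2 ≤ n) {h : Fin D → ℕ} (hh : ∑ j, h j = n) :
    ∫⁻ x, certErr n p h x ∂(noisyHashedLaw p B h) ≤ ENNReal.ofReal
      (40 * (Real.sqrt (Cp p * (n + B) * Real.log n) + n * Real.log n / Real.sqrt B)) := by
  have := isProbabilityMeasure_dlap hp0 hp1
  have := isProbabilityMeasure_uniformOn_hash (D := D) hB
  rw [noisyHashedLaw, lintegral_map (measurable_of_pi_int _) (measurable_noisyHash h)]
  set A := Real.sqrt (Cp p * (n + B) * Real.log n) with hA
  have hA0 : 0 ≤ A := Real.sqrt_nonneg _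
  have hBD : (0 : ℝ) < (B : ℝ) ^ D := by positivity
  have hinner : ∀ H : Fin D → Fin B, ∫⁻ z, ENNReal.ofReal
      (8 * noiseErr n p (hashed H h) z + 4 * hashErr n h H) ∂(Measure.pi fun _ => dlap p) ≤
      ENNReal.ofReal (40 * A + 4 * hashErr n h H) := by
    intro H
    have hnoise : Integrable (noiseErr n p (hashed H h)) (Measure.pi fun _ => dlap p) :=
      (memLp_noiseErr hp0 hp1 n _).integrable one_le_two
    have hint : Integrable (fun z => 8 * noiseErr n p (hashed H h) z + 4 * hashErr n h H)
        (Measure.pi fun _ => dlap p) := (hnoise.const_mul 8).add (integrable_const _)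
    have hnn : ∀ z, 0 ≤ 8 * noiseErr n p (hashed H h) z + 4 * hashErr n h H := fun z =>
      add_nonneg (mul_nonneg (by norm_num) (noiseErr_nonneg ..))
        (mul_nonneg (by norm_num) (hashErr_nonneg ..))
    rw [← ofReal_integral_eq_lintegral_ofReal hint (Filter.Eventually.of_forall hnn)]
    refine ENNReal.ofReal_le_ofReal ?_
    rw [integral_add (hnoise.const_mul 8) (integrable_const _), integral_const_mul,
      integral_const, probReal_univ, one_smul]
    have := integral_noiseErr_le hp0 hp1 hn (x := hashed H h) (by rw [sum_hashed, hh])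
    rw [← hA] at this
    linarith
  calc _ ≤ ∫⁻ q : (Fin D → Fin B) × (Fin B → ℤ), ENNReal.ofReal
        (8 * noiseErr n p (hashed q.1 h) q.2 + 4 * hashErr n h q.1)
        ∂((uniformOn (Set.univ : Set (Fin D → Fin B))).prod (Measure.pi fun _ => dlap p)) := by
        refine lintegral_mono fun q => (iInf_le _ q.1).trans (le_of_eq ?_)
        simp
    _ = ∫⁻ H, ∫⁻ z, ENNReal.ofReal (8 * noiseErr n p (hashed H h) z + 4 * hashErr n h H)
        ∂(Measure.pi fun _ => dlap p) ∂(uniformOn (Set.univ : Set (Fin D → Fin B))) :=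
        lintegral_prod _ (measurable_of_countable _).aemeasurable
    _ ≤ ∫⁻ H, ENNReal.ofReal (40 * A + 4 * hashErr n h H)
        ∂(uniformOn (Set.univ : Set (Fin D → Fin B))) := lintegral_mono hinner
    _ ≤ _ := by
        rw [lintegral_ofReal_uniformOn_hash hB fun H =>
          add_nonneg (by positivity) (mul_nonneg (by norm_num) (hashErr_nonneg ..))]
        refine ENNReal.ofReal_le_ofReal ?_
        have hmean := mean_l1_hash_error_le hB hn hh
        have hT : 0 ≤ n * Real.log n / Real.sqrt B := by
          have := Real.log_natCast_nonneg n
          positivity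
        have hc : (∑ _H : Fin D → Fin B, 40 * A) / (B : ℝ) ^ D = 40 * A := by
          simp [mul_div_cancel_left₀ _ hBD.ne']
        rw [Finset.sum_add_distrib, add_div, hc, ← Finset.mul_sum, mul_div_assoc]
        unfold hashErr
        linarith

/-- Markov's inequality for `∑ j, h j * coll H h j`, a natural number that is positive as soon as
there is a collision and has mean at most `n² / B`. -/
theorem uniformOn_collision_le {D B n : ℕ} (hB : 0 < B) {h : Fin D → ℕ} (hh : ∑ j, h j = n) :
    uniformOn (Set.univ : Set (Fin D → Fin B)) {H | ¬ NoCollision h H} ≤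
      ENNReal.ofReal ((n : ℝ) ^ 2 / B) := by
  have hBD : (0 : ℝ) < (B : ℝ) ^ D := by positivity
  have hB' : (0 : ℝ) < B := by positivity
  have hnn : ∀ H : Fin D → Fin B, 0 ≤ ∑ j, (h j : ℝ) * coll H h j :=
    fun H => Finset.sum_nonneg fun _ _ => by positivity
  rw [← lintegral_indicator_one (Set.toFinite _).measurableSet]
  calc _ ≤ ∫⁻ H, ENNReal.ofReal (∑ j, (h j : ℝ) * coll H h j)
        ∂(uniformOn (Set.univ : Set (Fin D → Fin B))) := by
        refine lintegral_mono fun H => ?_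
        refine Set.indicator_le (g := fun H : Fin D → Fin B =>
          ENNReal.ofReal (∑ j, (h j : ℝ) * coll H h j)) (fun H hH => ?_) H
        have hH' : ¬ NoCollision h H := hH
        unfold NoCollision at hH'
        push Not at hH'
        obtain ⟨j, hj, hc⟩ := hH'
        rw [Pi.one_apply, ENNReal.one_le_ofReal]
        have h1 : (1 : ℝ) ≤ (h j : ℝ) * coll H h j := by
          exact_mod_cast Nat.mul_pos (Nat.pos_of_ne_zero hj) (Nat.pos_of_ne_zero hc)
        exact h1.trans (Finset.single_le_sum (f := fun j => (h j : ℝ) * coll H h j)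
          (fun _ _ => by positivity) (Finset.mem_univ j))
    _ ≤ _ := by
        rw [lintegral_ofReal_uniformOn_hash hB hnn]
        refine ENNReal.ofReal_le_ofReal ?_
        rw [div_le_div_iff₀ hBD hB', Finset.sum_comm]
        calc _ = ∑ j, (h j : ℝ) * ((∑ H : Fin D → Fin B, (coll H h j : ℝ)) * B) := by
              rw [Finset.sum_mul]
              refine Finset.sum_congr rfl fun j _ => ?_
              rw [← Finset.mul_sum, mul_assoc]
          _ ≤ ∑ j, (h j : ℝ) * (n * (B : ℝ) ^ D) := by
              refine Finset.sum_le_sum fun j _ => mul_le_mul_of_nonneg_left ?_ (by positivity)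
              exact hh ▸ sum_coll_le h j
          _ = _ := by
              have : ∑ j, (h j : ℝ) = n := by exact_mod_cast hh
              rw [← Finset.sum_mul, this]
              ring

theorem pi_dlap_tail_le {p : ℝ} (hp0 : 0 < p) (hp1 : p < 1) (B t : ℕ) :
    (Measure.pi fun _ : Fin B => dlap p) {z | ∃ i, t ≤ (z i).natAbs} ≤
      ENNReal.ofReal (B * (2 * p ^ t)) := by
  have := isProbabilityMeasure_dlap hp0 hp1
  have hset : {z : Fin B → ℤ | ∃ i, t ≤ (z i).natAbs} =
      ⋃ i, Function.eval i ⁻¹' {z : ℤ | t ≤ z.natAbs} := by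
    ext z; simp
  rw [hset]
  refine (measure_iUnion_le _).trans ?_
  rw [tsum_fintype]
  calc _ ≤ ∑ _i : Fin B, ENNReal.ofReal (2 * p ^ t) := by
        refine Finset.sum_le_sum fun i _ => ?_
        rw [(measurePreserving_eval (fun _ : Fin B => dlap p) i).measure_preimage
          (Set.to_countable _).measurableSet.nullMeasurableSet]
        exact dlap_tail_le hp0 hp1 t
    _ = _ := by
        rw [Finset.sum_const, Finset.card_univ, Fintype.card_fin, nsmul_eq_mul,
          ENNReal.ofReal_mul (p := (B : ℝ)) (by positivity), ENNReal.ofReal_natCast]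

theorem radius_nonneg {n B : ℕ} {p : ℝ} (hp0 : 0 < p) (hp1 : p < 1) (hn : 1 ≤ n) (hB : 1 ≤ B) :
    0 ≤ radius n B p := by
  have h1 : (1 : ℝ) ≤ 2 * n * B := by
    have : 1 ≤ 2 * n * B := Nat.one_le_iff_ne_zero.2 (by positivity)
    exact_mod_cast this
  have h2 := Real.log_nonneg h1
  have h3 : 0 ≤ Real.log (1 / p) := Real.log_nonneg (one_le_one_div hp0 hp1.le)
  unfold radius
  positivity

/-- By the choice of radius, `p ^ radius = (2 n B)⁻¹⁰`, which beats both the union bound over `B`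
buckets and the trivial error of order `n²`. -/
theorem mul_pow_radius_le {n B : ℕ} {p : ℝ} (hp0 : 0 < p) (hp1 : p < 1) (hn : 1 ≤ n)
    (hB : 1 ≤ B) : (n : ℝ) ^ 2 * (B * (2 * p ^ (⌊radius n B p⌋₊ + 1))) ≤ 2 := by
  have hn' : (1 : ℝ) ≤ n := by exact_mod_cast hn
  have hB' : (1 : ℝ) ≤ B := by exact_mod_cast hB
  have hx : (1 : ℝ) ≤ 2 * n * B := by nlinarith
  have hL : 0 < Real.log (1 / p) := Real.log_pos (one_lt_one_div hp0 hp1)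
  have hlog : Real.log (1 / p) = -Real.log p := by rw [one_div, Real.log_inv]
  have hpow : p ^ (⌊radius n B p⌋₊ + 1) ≤ ((2 * n * B : ℝ) ^ 10)⁻¹ := by
    calc p ^ (⌊radius n B p⌋₊ + 1) = p ^ ((⌊radius n B p⌋₊ + 1 : ℕ) : ℝ) :=
          (Real.rpow_natCast p _).symm
      _ ≤ p ^ radius n B p := by
          refine Real.rpow_le_rpow_of_exponent_ge hp0 hp1.le ?_
          push_cast
          exact (Nat.lt_floor_add_one _).le
      _ = ((2 * n * B : ℝ) ^ 10)⁻¹ := by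
          rw [Real.rpow_def_of_pos hp0, radius,
            show Real.log p * (10 * Real.log (2 * n * B) / Real.log (1 / p)) =
              -(10 * Real.log (2 * n * B)) by
                have : Real.log p ≠ 0 := by intro h0; rw [hlog, h0] at hL; simp at hL
                rw [hlog]; field_simp,
            Real.exp_neg, show 10 * Real.log (2 * (n : ℝ) * B) =
              ((10 : ℕ) : ℝ) * Real.log (2 * n * B) by norm_num,
            Real.exp_nat_mul, Real.exp_log (by linarith)]
  have hle : (n : ℝ) ^ 2 * B ≤ (2 * n * B : ℝ) ^ 10 := by
    calc (n : ℝ) ^ 2 * B ≤ (2 * n * B : ℝ) ^ 2 := by nlinarith [sq_nonneg (n : ℝ)]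
      _ ≤ _ := pow_le_pow_right₀ hx (by norm_num)
  calc _ = 2 * ((n : ℝ) ^ 2 * B * p ^ (⌊radius n B p⌋₊ + 1)) := by ring
    _ ≤ 2 * ((2 * n * B : ℝ) ^ 10 * ((2 * n * B : ℝ) ^ 10)⁻¹) := by gcongr
    _ = 2 := by rw [mul_inv_cancel₀ (by positivity), mul_one]

theorem noisyHashedLaw_not_isClose_le {D B n : ℕ} {p : ℝ} (hp0 : 0 < p) (hp1 : p < 1)
    (hB : 1 ≤ B) (hn : 1 ≤ n) {h : Fin D → ℕ} (hh : ∑ j, h j = n) :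
    noisyHashedLaw p B h {y | ¬ IsClose n p h y} ≤ ENNReal.ofReal ((n : ℝ) ^ 2 / B +
      B * (2 * p ^ (⌊radius n B p⌋₊ + 1))) := by
  have := isProbabilityMeasure_dlap hp0 hp1
  have := isProbabilityMeasure_uniformOn_hash (D := D) hB
  rw [noisyHashedLaw, Measure.map_apply (measurable_noisyHash h)
    (Set.to_countable _).measurableSet]
  have hR := radius_nonneg hp0 hp1 hn hB
  -- The noise is integral, so exceeding the radius means reaching `t + 1`.
  set t := ⌊radius n B p⌋₊ with ht
  have hsub : ((fun q : (Fin D → Fin B) × (Fin B → ℤ) => fun i => (hashed q.1 h i : ℤ) + q.2 i) ⁻¹'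
      {y | ¬ IsClose n p h y}) ⊆
      ({H | ¬ NoCollision h H} ×ˢ Set.univ) ∪ (Set.univ ×ˢ {z | ∃ i, t + 1 ≤ (z i).natAbs}) := by
    rintro ⟨H, z⟩ hq
    by_contra hc
    simp only [Set.mem_union, Set.mem_prod, Set.mem_univ, and_true, true_and, not_or] at hc
    have hH : NoCollision h H := not_not.1 hc.1
    have hz : ∀ i, (z i).natAbs ≤ t := fun i => by
      by_contra hi
      exact hc.2 ⟨i, by omega⟩
    refine hq fun i => ?_
    have hle := abs_padded_anonymize_sub_le hH hz i
    calc _ ≤ (t : ℝ) := by exact_mod_cast hle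
      _ ≤ _ := Nat.floor_le hR
  refine (measure_mono hsub).trans ((measure_union_le _ _).trans ?_)
  rw [Measure.prod_prod, Measure.prod_prod, measure_univ, measure_univ, mul_one, one_mul,
    ENNReal.ofReal_add (by positivity) (by positivity)]
  exact add_le_add (uniformOn_collision_le hB hh) (pi_dlap_tail_le hp0 hp1 B _)

/-! ### The expected error -/

theorem aemeasurable_l2sqError {D : ℕ} (h : Fin D → ℕ) {Ω : Type*} [MeasurableSpace Ω]
    {P : Measure Ω} {nhat : Ω → Fin D → ℕ} (hm : AEMeasurable nhat P) :
    AEMeasurable (fun ω => l2sqError h (nhat ω)) P :=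
  (measurable_of_countable (l2sqError h)).comp_aemeasurable hm

theorem l2sqError_run_le {D n B₁ B₂ : ℕ} {p : ℝ} {h : Fin D → ℕ} (hh : ∑ j, h j = n)
    {Ω : Type*} [MeasurableSpace Ω] {P : Measure Ω}
    {X : Ω → Fin B₁ → ℤ} {Y : Ω → Fin B₂ → ℤ} {nhat : Ω → Fin D → ℕ}
    (hrun : IsTwoHashRun n B₁ B₂ p h P X Y nhat) :
    ∀ᵐ ω ∂P, l2sqError h (nhat ω) ≤ 2 * (n : ℝ) ^ 2 :=
  hrun.output.mono fun _ hω => l2sqError_le hh hω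

theorem integrable_l2sqError {D n B₁ B₂ : ℕ} {p : ℝ} {h : Fin D → ℕ} (hh : ∑ j, h j = n)
    {Ω : Type*} [MeasurableSpace Ω] {P : Measure Ω} [IsProbabilityMeasure P]
    {X : Ω → Fin B₁ → ℤ} {Y : Ω → Fin B₂ → ℤ} {nhat : Ω → Fin D → ℕ}
    (hrun : IsTwoHashRun n B₁ B₂ p h P X Y nhat) :
    Integrable (fun ω => l2sqError h (nhat ω)) P :=
  Integrable.of_bound (aemeasurable_l2sqError h hrun.aemeasurable).aestronglyMeasurable
    (2 * (n : ℝ) ^ 2) ((l2sqError_run_le hh hrun).mono fun _ hω => by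
      rwa [Real.norm_of_nonneg (l2sqError_nonneg ..)])

theorem integral_l2sqError_le_trivial {D n B₁ B₂ : ℕ} {p : ℝ} {h : Fin D → ℕ}
    (hh : ∑ j, h j = n) {Ω : Type*} [MeasurableSpace Ω] {P : Measure Ω} [IsProbabilityMeasure P]
    {X : Ω → Fin B₁ → ℤ} {Y : Ω → Fin B₂ → ℤ} {nhat : Ω → Fin D → ℕ}
    (hrun : IsTwoHashRun n B₁ B₂ p h P X Y nhat) :
    ∫ ω, l2sqError h (nhat ω) ∂P ≤ 2 * (n : ℝ) ^ 2 := by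
  have := integral_mono_ae (integrable_l2sqError hh hrun) (integrable_const _)
    (l2sqError_run_le hh hrun)
  simpa using this

/-- Pointwise, the error is at most a function of `X` if `Y` is good and `2 n²` if it is not. Adding
the two bounds separates `X` from `Y`. -/
theorem lintegral_l2sqError_le {D n B₁ B₂ : ℕ} {p : ℝ} {h : Fin D → ℕ} (hh : ∑ j, h j = n)
    (hB₁ : 4 * n < B₁) (hB₂ : 1 ≤ B₂) (hn : 2 ≤ n) (hp0 : 0 < p) (hp1 : p < 1)
    {Ω : Type*} [MeasurableSpace Ω] {P : Measure Ω}
    {X : Ω → Fin B₁ → ℤ} {Y : Ω → Fin B₂ → ℤ} {nhat : Ω → Fin D → ℕ}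
    (hrun : IsTwoHashRun n B₁ B₂ p h P X Y nhat) :
    ∫⁻ ω, ENNReal.ofReal (l2sqError h (nhat ω)) ∂P ≤
      ENNReal.ofReal (4 * radius n B₂ p) * ENNReal.ofReal
        (40 * (Real.sqrt (Cp p * (n + B₁) * Real.log n) + n * Real.log n / Real.sqrt B₁)) +
      ENNReal.ofReal (2 * (n : ℝ) ^ 2) * ENNReal.ofReal ((n : ℝ) ^ 2 / B₂ +
        B₂ * (2 * p ^ (⌊radius n B₂ p⌋₊ + 1))) := by
  have hR := radius_nonneg hp0 hp1 (by omega : 1 ≤ n) hB₂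
  set bad : (Fin B₂ → ℤ) → ℝ≥0∞ := Set.indicator {y | ¬ IsClose n p h y} 1 with hbad
  have hcert : Measurable (certErr n p h : (Fin B₁ → ℤ) → ℝ≥0∞) := measurable_of_pi_int _
  have hbadm : Measurable bad := measurable_of_pi_int _
  have hpt : ∀ᵐ ω ∂P, ENNReal.ofReal (l2sqError h (nhat ω)) ≤
      ENNReal.ofReal (4 * radius n B₂ p) * certErr n p h (X ω) +
        ENNReal.ofReal (2 * (n : ℝ) ^ 2) * bad (Y ω) := by
    filter_upwards [hrun.output] with ω hω
    by_cases hy : IsClose n p h (Y ω)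
    · obtain ⟨m₁, hm₁, hle⟩ := l2sqError_le_of_isClose hh hω hy
      refine le_add_right ((ENNReal.ofReal_le_ofReal hle).trans ?_)
      rw [ENNReal.ofReal_mul (by positivity)]
      exact mul_le_mul_right (ofReal_l1_le_certErr hh hB₁ hm₁) _
    · refine le_add_left ((ENNReal.ofReal_le_ofReal (l2sqError_le hh hω)).trans ?_)
      rw [hbad, Set.indicator_of_mem (show Y ω ∈ {y | ¬ IsClose n p h y} from hy), Pi.one_apply,
        mul_one]
  refine (lintegral_mono_ae hpt).trans ?_
  have hX : AEMeasurable (fun ω => certErr n p h (X ω)) P :=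
    hcert.comp_aemeasurable hrun.law_fst.aemeasurable
  have hY : AEMeasurable (fun ω => bad (Y ω)) P :=
    hbadm.comp_aemeasurable hrun.law_snd.aemeasurable
  rw [lintegral_add_left' (hX.const_mul _), lintegral_const_mul'' _ hX, lintegral_const_mul'' _ hY,
    hrun.law_fst.lintegral_comp hcert.aemeasurable, hrun.law_snd.lintegral_comp hbadm.aemeasurable,
    hbad, lintegral_indicator_one (Set.to_countable _).measurableSet]
  gcongr
  · exact lintegral_certErr_le hp0 hp1 (by omega) hn hh
  · exact noisyHashedLaw_not_isClose_le hp0 hp1 hB₂ (by omega) hh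

theorem integral_l2sqError_le {D n B₁ B₂ : ℕ} {p : ℝ} {h : Fin D → ℕ} (hh : ∑ j, h j = n)
    (hB₁ : 4 * n < B₁) (hB₂ : 1 ≤ B₂) (hp0 : 0 < p) (hp1 : p < 1)
    {Ω : Type*} [MeasurableSpace Ω] {P : Measure Ω} [IsProbabilityMeasure P]
    {X : Ω → Fin B₁ → ℤ} {Y : Ω → Fin B₂ → ℤ} {nhat : Ω → Fin D → ℕ}
    (hrun : IsTwoHashRun n B₁ B₂ p h P X Y nhat) :
    ∫ ω, l2sqError h (nhat ω) ∂P ≤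
      3200 * (Real.log (n * B₂) / Real.log (1 / p) *
        (Real.sqrt (Cp p * (n + B₁) * Real.log n) + n * Real.log n / Real.sqrt B₁)) +
      3200 * ((n : ℝ) ^ 4 / B₂ + 1) := by
  have hB₂' : (1 : ℝ) ≤ B₂ := by exact_mod_cast hB₂
  have hlogp : 0 < Real.log (1 / p) := Real.log_pos (one_lt_one_div hp0 hp1)
  have h40 : 0 ≤ (n : ℝ) ^ 4 / B₂ := by positivity
  -- For `n ≤ 1` one has `log n = 0` (with `log 0 = 0`), the main term vanishes and the additive
  -- constant covers `2 n²`.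
  rcases Nat.lt_or_ge n 2 with hn | hn
  · have hlog : Real.log n = 0 := by
      interval_cases n <;> simp
    have hn2 : (n : ℝ) ^ 2 ≤ 1 := by
      interval_cases n <;> simp
    have := integral_l2sqError_le_trivial hh hrun
    simp only [hlog, mul_zero, Real.sqrt_zero, zero_div, add_zero, zero_add]
    linarith
  have hn' : (2 : ℝ) ≤ n := by exact_mod_cast hn
  have hR := radius_nonneg hp0 hp1 (by omega : 1 ≤ n) hB₂
  set S := Real.sqrt (Cp p * (n + B₁) * Real.log n) + n * Real.log n / Real.sqrt B₁ with hS
  have hS0 : 0 ≤ S := by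
    have := Real.log_natCast_nonneg n
    positivity
  have hq : 0 ≤ (B₂ : ℝ) * (2 * p ^ (⌊radius n B₂ p⌋₊ + 1)) := by positivity
  have hint : ∫ ω, l2sqError h (nhat ω) ∂P ≤ 4 * radius n B₂ p * (40 * S) +
      2 * (n : ℝ) ^ 2 * ((n : ℝ) ^ 2 / B₂ + B₂ * (2 * p ^ (⌊radius n B₂ p⌋₊ + 1))) := by
    rw [integral_eq_lintegral_of_nonneg_ae
      (Filter.Eventually.of_forall fun ω => l2sqError_nonneg h _)
      (aemeasurable_l2sqError h hrun.aemeasurable).aestronglyMeasurable]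
    refine ENNReal.toReal_le_of_le_ofReal (by positivity) ?_
    rw [ENNReal.ofReal_add (by positivity) (by positivity), ENNReal.ofReal_mul (by positivity),
      ENNReal.ofReal_mul (p := 2 * (n : ℝ) ^ 2) (by positivity)]
    exact lintegral_l2sqError_le hh hB₁ hB₂ hn hp0 hp1 hrun
  have htail := mul_pow_radius_le hp0 hp1 (by omega : 1 ≤ n) hB₂
  -- Here `n * B₂ ≥ 2` absorbs the `2` inside the logarithm. The constant `3200` is `4 * 40 * 20`.
  have hrad : radius n B₂ p ≤ 20 * (Real.log (n * B₂) / Real.log (1 / p)) := by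
    have h2 : (2 : ℝ) ≤ n * B₂ := by nlinarith
    have hlog : Real.log (2 * n * B₂) ≤ 2 * Real.log (n * B₂) := by
      rw [mul_assoc, Real.log_mul (by norm_num) (by positivity)]
      have := Real.log_le_log (by norm_num) h2
      linarith
    rw [radius, ← mul_div_assoc]
    exact div_le_div_of_nonneg_right (by linarith) hlogp.le
  have hmain : radius n B₂ p * S ≤ 20 * (Real.log (n * B₂) / Real.log (1 / p)) * S := by gcongr
  have h4 : (n : ℝ) ^ 2 * ((n : ℝ) ^ 2 / B₂) = (n : ℝ) ^ 4 / B₂ := by ring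
  calc _ ≤ _ := hint
    _ = 160 * (radius n B₂ p * S) + 2 * ((n : ℝ) ^ 2 * ((n : ℝ) ^ 2 / B₂)) +
        2 * ((n : ℝ) ^ 2 * (B₂ * (2 * p ^ (⌊radius n B₂ p⌋₊ + 1)))) := by ring
    _ ≤ _ := by
        rw [h4]
        linarith

/-! ### The choice of parameters -/

theorem Cp_exp_le {ε : ℝ} (hε0 : 0 < ε) (hε1 : ε ≤ 1) :
    Cp (Real.exp (-ε / 4)) ≤ 2 ^ 16 / ε ^ 5 := by
  set p := Real.exp (-ε / 4) with hp
  have hp0 : 0 < p := Real.exp_pos _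
  have hp1 : p < 1 := Real.exp_lt_one_iff.2 (by linarith)
  -- From `exp (ε / 4) ≥ 1 + ε / 4` and `ε ≤ 1`. The final constant is `2 * 8 ^ 5 = 2 ^ 16`.
  have hgap : ε / 8 ≤ 1 - p := by
    have h1 := Real.add_one_le_exp (ε / 4)
    have h2 : p * Real.exp (ε / 4) = 1 := by
      rw [hp, ← Real.exp_add]; ring_nf; exact Real.exp_zero
    nlinarith
  have hg0 : 0 < 1 - p := by linarith
  have h5 : p / (1 - p) ≤ 1 / (1 - p) ^ 5 := by
    rw [div_le_div_iff₀ hg0 (by positivity)]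
    have : (1 - p) ^ 5 ≤ 1 - p := pow_le_of_le_one hg0.le (by linarith) (by norm_num)
    nlinarith
  have h6 : p ^ 2 / (1 - p) ^ 5 ≤ 1 / (1 - p) ^ 5 := by
    gcongr
    exact pow_le_one₀ hp0.le hp1.le
  calc Cp p ≤ 1 / (1 - p) ^ 5 + 1 / (1 - p) ^ 5 := add_le_add h6 h5
    _ ≤ 1 / (ε / 8) ^ 5 + 1 / (ε / 8) ^ 5 := by gcongr
    _ = 2 ^ 16 / ε ^ 5 := by field_simp; norm_num

/-- The two leading terms for `n = w ^ 2`, `log n = s ^ 4` and `ε = e ^ 2`. -/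
theorem leading_terms_le {w s e c b : ℝ} (hw : 1 ≤ w) (hs : 1 ≤ s) (he0 : 0 < e)
    (hc : c ≤ 2 ^ 16 / (e ^ 2) ^ 5) (hb1 : b ≤ 2 * (w ^ 2 * s ^ 2))
    (hb2 : w ^ 2 * s ^ 2 / 4 ≤ b) (he1 : e ≤ 1) :
    5 * s ^ 4 / (e ^ 2 / 4) * (Real.sqrt (c * (w ^ 2 + b) * s ^ 4) + w ^ 2 * s ^ 4 / Real.sqrt b) ≤
      10280 * (w * s ^ 7 / e ^ 7) := by
  have hw0 : 0 < w := by linarith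
  have hs0 : 0 < s := by linarith
  have hb0 : 0 ≤ b := le_trans (by positivity) hb2
  have h1 : Real.sqrt (c * (w ^ 2 + b) * s ^ 4) ≤ 512 * (w * s ^ 3 / e ^ 5) := by
    refine Real.sqrt_le_iff.2 ⟨by positivity, ?_⟩
    have hwb : w ^ 2 + b ≤ 4 * (w ^ 2 * s ^ 2) := by
      have : w ^ 2 * 1 ≤ w ^ 2 * s ^ 2 := by gcongr; exact one_le_pow₀ hs
      linarith
    calc c * (w ^ 2 + b) * s ^ 4 ≤ 2 ^ 16 / (e ^ 2) ^ 5 * (4 * (w ^ 2 * s ^ 2)) * s ^ 4 := by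
          gcongr
      _ = (512 * (w * s ^ 3 / e ^ 5)) ^ 2 := by field_simp; norm_num
  have h2 : w * s / 2 ≤ Real.sqrt b := by
    refine Real.le_sqrt_of_sq_le ?_
    calc (w * s / 2) ^ 2 = w ^ 2 * s ^ 2 / 4 := by ring
      _ ≤ b := hb2
  have h3 : w ^ 2 * s ^ 4 / Real.sqrt b ≤ 2 * (w * s ^ 3 / e ^ 5) := by
    calc w ^ 2 * s ^ 4 / Real.sqrt b ≤ w ^ 2 * s ^ 4 / (w * s / 2) := by gcongr
      _ = 2 * (w * s ^ 3 / 1) := by field_simp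
      _ ≤ 2 * (w * s ^ 3 / e ^ 5) := by
          gcongr
          exact pow_le_one₀ he0.le he1
  calc _ ≤ 5 * s ^ 4 / (e ^ 2 / 4) * (512 * (w * s ^ 3 / e ^ 5) + 2 * (w * s ^ 3 / e ^ 5)) := by
        gcongr
    -- `20 * (512 + 2) = 10280`.
    _ = 10280 * (w * s ^ 7 / e ^ 7) := by field_simp; norm_num

theorem integral_l2sqError_le_of_large {D n B₁ B₂ : ℕ} {ε p : ℝ} {h : Fin D → ℕ}
    (hh : ∑ j, h j = n) (hε0 : 0 < ε) (hε1 : ε ≤ 1) (hp : p = Real.exp (-ε / 4))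
    (hlarge : 25 ≤ Real.log n) (hB₁ : |(B₁ : ℝ) - n * Real.sqrt (Real.log n)| ≤ 1)
    (hB₂ : B₂ = n ^ 4)
    {Ω : Type*} [MeasurableSpace Ω] {P : Measure Ω} [IsProbabilityMeasure P]
    {X : Ω → Fin B₁ → ℤ} {Y : Ω → Fin B₂ → ℤ} {nhat : Ω → Fin D → ℕ}
    (hrun : IsTwoHashRun n B₁ B₂ p h P X Y nhat) :
    ∫ ω, l2sqError h (nhat ω) ∂P ≤
      3200 * 10282 * (Real.sqrt n * Real.log n ^ (7 / 4 : ℝ) / ε ^ (7 / 2 : ℝ)) := by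
  have hn1 : 2 ≤ n := by
    by_contra hlt
    have : n < 2 := by omega
    interval_cases n <;> norm_num at hlarge
  have hn' : (2 : ℝ) ≤ n := by exact_mod_cast hn1
  have hp0 : 0 < p := hp ▸ Real.exp_pos _
  have hp1 : p < 1 := hp ▸ Real.exp_lt_one_iff.2 (by linarith)
  obtain ⟨w, hw⟩ : ∃ w, w = Real.sqrt n := ⟨_, rfl⟩
  obtain ⟨s, hs⟩ : ∃ s, s = Real.log n ^ (1 / 4 : ℝ) := ⟨_, rfl⟩
  obtain ⟨e, he⟩ : ∃ e, e = Real.sqrt ε := ⟨_, rfl⟩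
  have hL0 : 0 ≤ Real.log n := by linarith
  have hs0 : 0 ≤ s := hs ▸ Real.rpow_nonneg hL0 _
  have hw2 : (n : ℝ) = w ^ 2 := by rw [hw, Real.sq_sqrt (by linarith)]
  have he2 : ε = e ^ 2 := by rw [he, Real.sq_sqrt hε0.le]
  have hs4 : Real.log n = s ^ 4 := by
    rw [hs, ← Real.rpow_natCast, ← Real.rpow_mul hL0]; norm_num
  have hs7 : Real.log n ^ (7 / 4 : ℝ) = s ^ 7 := by
    rw [hs, ← Real.rpow_natCast, ← Real.rpow_mul hL0]; norm_num
  have he7 : ε ^ (7 / 2 : ℝ) = e ^ 7 := by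
    rw [he, Real.sqrt_eq_rpow, ← Real.rpow_natCast, ← Real.rpow_mul hε0.le]; norm_num
  have hs2 : Real.sqrt (Real.log n) = s ^ 2 := by
    rw [hs4, show s ^ 4 = (s ^ 2) ^ 2 by ring, Real.sqrt_sq (by positivity)]
  have hw1 : 1 ≤ w := by rw [hw]; exact Real.one_le_sqrt.2 (by linarith)
  have he0 : 0 < e := he ▸ Real.sqrt_pos.2 hε0
  have he1 : e ≤ 1 := by rw [he]; exact Real.sqrt_le_one.2 hε1
  have hs5 : 5 ≤ s ^ 2 := by
    rw [← hs2]; exact Real.le_sqrt_of_sq_le (by linarith)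
  have hs1 : 1 ≤ s := by nlinarith
  have hBabs := abs_le.1 hB₁
  rw [hs2] at hBabs
  -- The threshold `log n ≥ 25` gives `B₁ ≥ 5 n - 1`, which leaves room for the rounding.
  have hB4 : 4 * n < B₁ := by
    have : (4 * n : ℝ) < B₁ := by nlinarith
    exact_mod_cast this
  have hmain := integral_l2sqError_le hh hB4 (hB₂ ▸ Nat.one_le_pow _ _ (by omega)) hp0 hp1 hrun
  have hCp : Cp p ≤ 2 ^ 16 / (e ^ 2) ^ 5 := by
    rw [← he2, hp]; exact Cp_exp_le hε0 hε1
  have hns : 2 * 5 ≤ (n : ℝ) * s ^ 2 := by gcongr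
  have hlead := leading_terms_le (b := (B₁ : ℝ)) hw1 hs1 he0 hCp
    (by rw [← hw2]; linarith) (by rw [← hw2]; linarith) he1
  have hlogp : Real.log (1 / p) = e ^ 2 / 4 := by
    rw [one_div, Real.log_inv, hp, Real.log_exp, ← he2]; ring
  have hlognB : Real.log (n * (B₂ : ℝ)) = 5 * s ^ 4 := by
    rw [hB₂, Nat.cast_pow, ← pow_succ', Real.log_pow, hs4]; norm_num
  -- Absorbs the additive term `n ^ 4 / B₂ + 1 = 2`, turning `10280` into `10282`.
  have hone : 1 ≤ w * s ^ 7 / e ^ 7 := by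
    rw [one_le_div (by positivity)]
    calc e ^ 7 ≤ 1 * 1 := by rw [one_mul]; exact pow_le_one₀ he0.le he1
      _ ≤ w * s ^ 7 := by gcongr; exact one_le_pow₀ hs1
  have hratio : (n : ℝ) ^ 4 / B₂ = 1 := by
    rw [hB₂, Nat.cast_pow]
    exact div_self (by positivity)
  rw [hlogp, hlognB, hratio, hs4] at hmain
  rw [hs7, he7, ← hw]
  rw [hw2] at hmain
  linarith

/-- Only the finitely many `n ≤ exp 25` are left, so the trivial error `2 n²` is a constant, and the
target rate is at least `1 / 4`. -/
theorem integral_l2sqError_le_of_small {D n B₁ B₂ : ℕ} {ε p : ℝ} {h : Fin D → ℕ}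
    (hh : ∑ j, h j = n) (hn : 2 ≤ n) (hε0 : 0 < ε) (hε1 : ε ≤ 1) (hsmall : Real.log n ≤ 25)
    {Ω : Type*} [MeasurableSpace Ω] {P : Measure Ω} [IsProbabilityMeasure P]
    {X : Ω → Fin B₁ → ℤ} {Y : Ω → Fin B₂ → ℤ} {nhat : Ω → Fin D → ℕ}
    (hrun : IsTwoHashRun n B₁ B₂ p h P X Y nhat) :
    ∫ ω, l2sqError h (nhat ω) ∂P ≤
      8 * Real.exp 25 ^ 2 * (Real.sqrt n * Real.log n ^ (7 / 4 : ℝ) / ε ^ (7 / 2 : ℝ)) := by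
  have hn' : (2 : ℝ) ≤ n := by exact_mod_cast hn
  have hlog := one_le_two_mul_log hn
  have hle : (n : ℝ) ≤ Real.exp 25 := (Real.log_le_iff_le_exp (by linarith)).1 hsmall
  have h1 : 1 / 4 ≤ Real.log n ^ (7 / 4 : ℝ) := by
    calc (1 / 4 : ℝ) = (1 / 2 : ℝ) ^ (2 : ℝ) := by norm_num
      _ ≤ (1 / 2 : ℝ) ^ (7 / 4 : ℝ) :=
          Real.rpow_le_rpow_of_exponent_ge (by norm_num) (by norm_num) (by norm_num)
      _ ≤ Real.log n ^ (7 / 4 : ℝ) :=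
          Real.rpow_le_rpow (by norm_num) (by linarith) (by norm_num)
  have h2 : ε ^ (7 / 2 : ℝ) ≤ 1 := Real.rpow_le_one hε0.le hε1 (by norm_num)
  have h3 : 0 < ε ^ (7 / 2 : ℝ) := Real.rpow_pos_of_pos hε0 _
  have h4 : 1 ≤ Real.sqrt n := Real.one_le_sqrt.2 (by linarith)
  have h5 : 1 / 4 ≤ Real.sqrt n * Real.log n ^ (7 / 4 : ℝ) / ε ^ (7 / 2 : ℝ) := by
    rw [le_div_iff₀ h3]
    calc 1 / 4 * ε ^ (7 / 2 : ℝ) ≤ 1 * (1 / 4) := by linarith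
      _ ≤ Real.sqrt n * Real.log n ^ (7 / 4 : ℝ) := by gcongr
  calc _ ≤ 2 * (n : ℝ) ^ 2 := integral_l2sqError_le_trivial hh hrun
    _ ≤ 8 * Real.exp 25 ^ 2 * (1 / 4) := by
        have : (n : ℝ) ^ 2 ≤ Real.exp 25 ^ 2 := by gcongr
        linarith
    _ ≤ _ := by gcongr

end AnonHist

theorem theoremB2 :
    (∃ C : ℝ, 0 < C ∧
      ∀ (n D B₁ B₂ : ℕ) (p : ℝ) (h : Fin D → ℕ),
        ∑ j, h j = n → 4 * n < B₁ → 1 ≤ B₂ → 0 < p → p < 1 →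
        ∀ (Ω : Type*) [MeasurableSpace Ω] (P : Measure Ω) [IsProbabilityMeasure P]
          (X : Ω → Fin B₁ → ℤ) (Y : Ω → Fin B₂ → ℤ) (nhat : Ω → Fin D → ℕ),
          AnonHist.IsTwoHashRun n B₁ B₂ p h P X Y nhat →
          Integrable (fun ω => AnonHist.l2sqError h (nhat ω)) P ∧
          ∫ ω, AnonHist.l2sqError h (nhat ω) ∂P ≤
            C * (Real.log (n * B₂) / Real.log (1 / p) *
              (Real.sqrt (AnonHist.Cp p * (n + B₁) * Real.log n)
                + n * Real.log n / Real.sqrt B₁))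
            + C * ((n : ℝ) ^ 4 / B₂ + 1)) ∧
    (∃ C : ℝ, 0 < C ∧
      ∀ (n D B₁ B₂ : ℕ) (ε p : ℝ) (h : Fin D → ℕ),
        ∑ j, h j = n → 2 ≤ n → 0 < ε → ε ≤ 1 → p = Real.exp (-ε / 4) →
        |(B₁ : ℝ) - n * Real.sqrt (Real.log n)| ≤ 1 → B₂ = n ^ 4 →
        ∀ (Ω : Type*) [MeasurableSpace Ω] (P : Measure Ω) [IsProbabilityMeasure P]
          (X : Ω → Fin B₁ → ℤ) (Y : Ω → Fin B₂ → ℤ) (nhat : Ω → Fin D → ℕ),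
          AnonHist.IsTwoHashRun n B₁ B₂ p h P X Y nhat →
          Integrable (fun ω => AnonHist.l2sqError h (nhat ω)) P ∧
          ∫ ω, AnonHist.l2sqError h (nhat ω) ∂P ≤
            C * (Real.sqrt n * Real.log n ^ (7 / 4 : ℝ) / ε ^ (7 / 2 : ℝ))) := by
  refine ⟨⟨3200, by norm_num, ?_⟩, ⟨3200 * 10282 + 8 * Real.exp 25 ^ 2, by positivity, ?_⟩⟩
  · intro n D B₁ B₂ p h hh hB₁ hB₂ hp0 hp1 Ω _ P _ X Y nhat hrun
    exact ⟨AnonHist.integrable_l2sqError hh hrun,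
      AnonHist.integral_l2sqError_le hh hB₁ hB₂ hp0 hp1 hrun⟩
  · intro n D B₁ B₂ ε p h hh hn hε0 hε1 hp hB₁ hB₂ Ω _ P _ X Y nhat hrun
    refine ⟨AnonHist.integrable_l2sqError hh hrun, ?_⟩
    have hlog := Real.log_natCast_nonneg n
    have h0 : 0 ≤ Real.sqrt n * Real.log n ^ (7 / 4 : ℝ) / ε ^ (7 / 2 : ℝ) := by positivity
    rw [add_mul]
    rcases le_total 25 (Real.log n) with hlarge | hsmall
    · exact (AnonHist.integral_l2sqError_le_of_large hh hε0 hε1 hp hlarge hB₁ hB₂ hrun).trans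
        (le_add_of_nonneg_right (by positivity))
    · exact (AnonHist.integral_l2sqError_le_of_small hh hn hε0 hε1 hsmall hrun).trans
        (le_add_of_nonneg_left (by positivity))
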